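/- Let $\mathcal D$ be an arbitrary directed acyclic graph on the vertices $1,\dots,p$, labelled in a parent ordering ($i\to j$ implies $i>j$). Write $\mathrm{pa}(i)$ for the set of parents of $i$, $pa_i=|\mathrm{pa}(i)|$, $\mathrm{fa}(i)=\{i\}\cup \mathrm{pa}(i)$, and let $E$ be the edge set with all loops $(i,i)$ included. For a symmetric matrix $A$ let $A^E=(A_{ij})_{(i,j)\in E}\in\mathbb R^{E}$, let $A_a$ be the principal submatrix with index set $a$, and put $\det A_\emptyset=1$. Let $\mathrm{PD}_{\mathcal D}$ be the set of positive definite $\Sigma$ such that $x\sim N_p(0,\Sigma)$ satisfies the ordered Markov property $x_i\perp x_{\{i+1,\dots,p\}\setminus \mathrm{pa}(i)}\mid x_{\mathrm{pa}(i)}$ for all $i$; let $\mathrm P_{\mathcal D}=\{\Sigma^{-1}:\Sigma\in \mathrm{PD}_{\mathcal D}\}$, $S_{\mathcal D}=\{\Sigma^E:\Sigma\in \mathrm{PD}_{\mathcal D}\}$ and $R_{\mathcal D}=\{\Omega^E:\Omega\in \mathrm P_{\mathcal D}\}$. Every element of $S_{\mathcal D}$ (of $R_{\mathcal D}$) is $A^E$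 for a unique $A$, its completion, in $\mathrm{PD}_{\mathcal D}$ (in $\mathrm P_{\mathcal D}$); $R_{\mathcal D}$ and $S_{\mathcal D}$ are open in $\mathbb R^E$, and the map $\Sigma^{-E}:=(\Sigma^{-1})^E\mapsto\Sigma^E$ $(\Sigma\in \mathrm{PD}_{\mathcal D})$ is a well-defined bijection $R_{\mathcal D}\to S_{\mathcal D}$. It is differentiable, and the absolute value of its Jacobian determinant at $\Sigma^{-E}$ is $$\prod_{i=1}^p\frac{(\det\Sigma_{\mathrm{fa}(i)})^{pa_i+2}}{(\det\Sigma_{\mathrm{pa}(i)})^{pa_i+1}}.$$ Let $U$ be a positive definite $p\times p$ matrix and let $\alpha\in\mathbb R^p$ with $\alpha_i>pa_i+2$ for all $i$. Let $\Theta_{\mathcal D}$ be the set of pairs $(D,L)$, where $D$ is a diagonal matrix with positive diagonal and $L$ is a unit lower triangular matrix with $L_{ij}=0$ whenever $i\ne j$ and $i\notin \mathrm{pa}(j)$. The DAG-Wishart distribution $\pi^{\Theta_{\mathcal D}}_{U,\alpha}$ on $\Theta_{\mathcal D}$ has density $$z_{\mathcal D}(U,\alpha)^{-1}\exp\{-\tfrac12\mathrm{tr}(LD^{-1}L^\top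 U)\}\prod_{i=1}^p D_{ii}^{-\alpha_i/2}$$ with respect to Lebesgue measure in the free entries $D_{ii}$ and $L_{ij}$ ($i\in \mathrm{pa}(j)$), where $$z_{\mathcal D}(U,\alpha)=\prod_{i=1}^p\frac{\Gamma(\frac{\alpha_i}{2}-\frac{pa_i}{2}-1)\,2^{\frac{\alpha_i}{2}-1}\,\pi^{pa_i/2}\,(\det U_{\mathrm{pa}(i)})^{\frac{\alpha_i}{2}-\frac{pa_i}{2}-\frac32}}{(\det U_{\mathrm{fa}(i)})^{\frac{\alpha_i}{2}-\frac{pa_i}{2}-1}}.$$ Let $\pi^{\mathrm{PD}_{\mathcal D}}_{U,\alpha}$ and $\pi^{S_{\mathcal D}}_{U,\alpha}$ (the inverse DAG-Wishart distribution on $S_{\mathcal D}$) be its images under $(D,L)\mapsto(LD^{-1}L^\top)^{-1}$ and $(D,L)\mapsto((LD^{-1}L^\top)^{-1})^E$. Then $\pi^{S_{\mathcal D}}_{U,\alpha}$ is a probability measure, and its density with respect to Lebesgue measure on $S_{\mathcal D}\subseteq\mathbb R^E$ is $$\Gamma\mapsto z_{\mathcal D}(U,\alpha)^{-1}\exp\{-\tfrac12\mathrm{tr}(\Sigma^{-1}U)\}\prod_{i=1}^p\frac{(\det\Sigma_{\mathrm{fa}(i)})^{-\alpha_i/2}}{(\det\Sigma_{\mathrm{pa}(i)})^{-\alpha_i/2+1}},$$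 where $\Sigma$ is the completion of $\Gamma$ in $\mathrm{PD}_{\mathcal D}$. Moreover, if $\Sigma\sim\pi^{\mathrm{PD}_{\mathcal D}}_{U,\alpha}$, then almost surely $\Sigma\in \mathrm{PD}_{\mathcal D}$ is the completion of $\Gamma=\Sigma^E$, and $\Gamma$ has this density. -/

import Mathlib

open MeasureTheory ProbabilityTheory Set
open scoped ENNReal Matrix

/-- A directed acyclic graph on the vertices `0, …, p - 1` given in a parent ordering: an arrow
`i → j` (written `Adj i j`) forces `j < i`, so that parents carry a larger label than their
children. Loops are not part of `Adj`; the diagonal entries are added where edges index matrix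
entries. -/
structure ParentOrderedDAG (p : ℕ) extends Digraph (Fin p) where
  lt_of_adj : ∀ i j : Fin p, Adj i j → j < i

namespace ParentOrderedDAG

noncomputable section

open scoped Classical

variable {p : ℕ} (D : ParentOrderedDAG p)

/-- The set of parents of `i`. -/
def pa (i : Fin p) : Finset (Fin p) := Finset.univ.filter fun j => D.Adj j i

/-- The family of `i`: the vertex `i` together with its parents. -/
def fa (i : Fin p) : Finset (Fin p) := insert i (D.pa i)

/-- The vertices that precede `i` in the parent ordering (that is, have a larger label) and are
not parents of `i`. -/
def nonpa (i : Fin p) : Finset (Fin p) := Finset.univ.filter fun j => i < j ∧ j ∉ D.pa i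

/-- The edges of the graph without loops. -/
abbrev Arrow : Type := {e : Fin p × Fin p // D.Adj e.1 e.2}

/-- The edge set, in which all loops are included. -/
abbrev Edge : Type := {e : Fin p × Fin p // e.1 = e.2 ∨ D.Adj e.1 e.2}

/-- The principal submatrix with rows and columns in `a`. -/
def sub (A : Matrix (Fin p) (Fin p) ℝ) (a : Finset (Fin p)) : Matrix a a ℝ :=
  A.submatrix Subtype.val Subtype.val

/-! ### Covariance and precision matrices of the Gaussian DAG model -/

/-- The coordinates of `x` with index in `a`. -/
def coords (a : Finset (Fin p)) (x : EuclideanSpace ℝ (Fin p)) : a → ℝ := fun j => x j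

lemma measurable_coords (a : Finset (Fin p)) : Measurable (coords a) := by
  unfold coords; fun_prop

/-- The ordered directed Markov property for the centred Gaussian distribution with covariance
matrix `S`: given its parents, each `x i` is conditionally independent of the preceding
non-parents. -/
def IsMarkov (S : Matrix (Fin p) (Fin p) ℝ) : Prop :=
  ∀ i : Fin p,
    CondIndepFun (MeasurableSpace.comap (coords (D.pa i)) inferInstance)
      (measurable_coords (D.pa i)).comap_le
      (fun x : EuclideanSpace ℝ (Fin p) => x i) (coords (D.nonpa i)) (multivariateGaussian 0 S)

/-- The space of covariance matrices of the Gaussian DAG model. -/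
def covSpace : Set (Matrix (Fin p) (Fin p) ℝ) := {S | S.PosDef ∧ D.IsMarkov S}

/-- The space of precision matrices of the Gaussian DAG model. -/
def precSpace : Set (Matrix (Fin p) (Fin p) ℝ) := (fun S => S⁻¹) '' D.covSpace

/-! ### Incomplete matrices -/

/-- The space of incomplete symmetric matrices: one free real entry for every edge, loops
included. As at most one of `(i, j)`, `(j, i)` is an edge when `i ≠ j`, this is the space of
symmetric functions on the undirected version of the edge set. Its Lebesgue measure is the
`volume` of this finite product of copies of `ℝ`. -/
abbrev IncMatrix : Type := D.Edge → ℝ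

/-- The projection of a symmetric matrix to its entries at the edges. -/
def proj (A : Matrix (Fin p) (Fin p) ℝ) : D.IncMatrix := fun e => A e.1.1 e.1.2

/-- The space of incomplete precision matrices. -/
def incPrec : Set D.IncMatrix := D.proj '' D.precSpace

/-- The space of incomplete covariance matrices. -/
def incCov : Set D.IncMatrix := D.proj '' D.covSpace

/-- The completion of an incomplete matrix in the space of covariance matrices
(arbitrary when there is none). -/
def covCompletion (G : D.IncMatrix) : Matrix (Fin p) (Fin p) ℝ :=
  Function.invFunOn D.proj D.covSpace G

/-- The completion of an incomplete matrix in the space of precision matrices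
(arbitrary when there is none). -/
def precCompletion (G : D.IncMatrix) : Matrix (Fin p) (Fin p) ℝ :=
  Function.invFunOn D.proj D.precSpace G

/-- The map that sends the incomplete precision matrix of `S` to the incomplete covariance matrix
of `S`: complete in the space of precision matrices, invert, project. -/
def precToCov (G : D.IncMatrix) : D.IncMatrix := D.proj (D.precCompletion G)⁻¹

/-! ### The DAG-Wishart distributions -/

/-- Coordinates `(d, l)` of the Cholesky space: the diagonal of the diagonal matrix and the free
entries of the unit lower triangular matrix. The Cholesky space is the subset `chol`. -/
abbrev CholCoord : Type := (Fin p → ℝ) × (D.Arrow → ℝ)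

/-- The Cholesky space: the diagonal entries are positive. -/
def chol : Set D.CholCoord := {t | ∀ i, 0 < t.1 i}

/-- The unit lower triangular matrix with entries `l` at the edges. -/
def lowerMatrix (l : D.Arrow → ℝ) : Matrix (Fin p) (Fin p) ℝ :=
  Matrix.of fun i j => if i = j then 1 else if h : D.Adj i j then l ⟨(i, j), h⟩ else 0

/-- The precision matrix `L D⁻¹ Lᵀ` of a Cholesky parameter. -/
def cholPrec (t : D.CholCoord) : Matrix (Fin p) (Fin p) ℝ :=
  D.lowerMatrix t.2 * (Matrix.diagonal t.1)⁻¹ * (D.lowerMatrix t.2)ᵀ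

/-- The normalizing constant of the DAG-Wishart distributions. -/
def normConst (U : Matrix (Fin p) (Fin p) ℝ) (α : Fin p → ℝ) : ℝ :=
  ∏ i, Real.Gamma (α i / 2 - ((D.pa i).card : ℝ) / 2 - 1) * 2 ^ (α i / 2 - 1)
    * Real.sqrt Real.pi ^ (D.pa i).card
    * (sub U (D.pa i)).det ^ (α i / 2 - ((D.pa i).card : ℝ) / 2 - 3 / 2)
    / (sub U (D.fa i)).det ^ (α i / 2 - ((D.pa i).card : ℝ) / 2 - 1)

/-- The DAG-Wishart distribution on the Cholesky space. -/
def wishartChol (U : Matrix (Fin p) (Fin p) ℝ) (α : Fin p → ℝ) : Measure D.CholCoord :=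
  (volume.restrict D.chol).withDensity fun t =>
    ENNReal.ofReal ((D.normConst U α)⁻¹ * Real.exp (-(1 / 2) * (D.cholPrec t * U).trace)
      * ∏ i, t.1 i ^ (-(1 / 2) * α i))

/-- The (Borel) product measurable structure on matrices. -/
instance matrixMeasurableSpace : MeasurableSpace (Matrix (Fin p) (Fin p) ℝ) :=
  inferInstanceAs (MeasurableSpace (Fin p → Fin p → ℝ))

/-- The inverse DAG-Wishart distribution on the space of covariance matrices: the image of the
DAG-Wishart distribution under `(D, L) ↦ (L D⁻¹ Lᵀ)⁻¹`. -/
def invWishartCov (U : Matrix (Fin p) (Fin p) ℝ) (α : Fin p → ℝ) :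
    Measure (Matrix (Fin p) (Fin p) ℝ) :=
  (D.wishartChol U α).map fun t => (D.cholPrec t)⁻¹

/-- The inverse DAG-Wishart distribution on the space of incomplete covariance matrices: the image
of the DAG-Wishart distribution under `(D, L) ↦ (L D⁻¹ Lᵀ)⁻¹`, projected to the edges. -/
def invWishartInc (U : Matrix (Fin p) (Fin p) ℝ) (α : Fin p → ℝ) : Measure D.IncMatrix :=
  (D.wishartChol U α).map fun t => D.proj (D.cholPrec t)⁻¹

/-- The measure on incomplete matrices whose Lebesgue density on `incCov` is
`z⁻¹ exp(-tr(S⁻¹ U) / 2) ∏ i, det(S_fa(i)) ^ (-α i / 2) / det(S_pa(i)) ^ (-α i / 2 + 1)`,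
with `S` the completion of the incomplete covariance matrix. -/
def densityMeasure (U : Matrix (Fin p) (Fin p) ℝ) (α : Fin p → ℝ) : Measure D.IncMatrix :=
  (volume.restrict D.incCov).withDensity fun G =>
    ENNReal.ofReal ((D.normConst U α)⁻¹
      * Real.exp (-(1 / 2) * ((D.covCompletion G)⁻¹ * U).trace)
      * ∏ i, (sub (D.covCompletion G) (D.fa i)).det ^ (-(1 / 2) * α i)
          / (sub (D.covCompletion G) (D.pa i)).det ^ (-(1 / 2) * α i + 1))

end

end ParentOrderedDAG

/-! ### Conditional independence of a regression residual -/

namespace ProbabilityTheory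

variable {β γ : Type*} [MeasurableSpace β] [MeasurableSpace γ]

/-! Everything is read off the Cholesky parameters `(D, L)`. Regress `x i` on its parents: the
residual is `∑ j, L j i * x j` with `L` unit lower triangular and supported on the graph, and it is
uncorrelated with, hence independent of, the parents. Conditional independence of `x i` and the
preceding non-parents then means that the residual is independent of parents and non-parents jointly
(`condIndepFun_iff_indepFun_residual`). These are all coordinates with a larger label, so for
Gaussian vectors the condition is that `Lᵀ Σ` vanishes above the diagonal (`isMarkov_iff`). In that
case `Lᵀ Σ L` is lower triangular and symmetric, hence diagonal, and the covariance space is the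
image of `(D, L) ↦ (L D⁻¹ Lᵀ)⁻¹` (`covSpace_eq_image`).

The entries at the edges determine `(D, L)` by triangular recursion, from the smallest label upwards
for precision matrices (`injOn_proj_cholPrec`) and from the largest downwards for covariance
matrices (`eq_of_proj_eq`). Both spaces of incomplete matrices thus have charts on the same
parameters. When edges are grouped by the vertex they point to, both Jacobian matrices are block
triangular, with absolute determinants `∏ D i ^ (-(pa i + 2))` and `∏ det Σ_pa(i)`
(`abs_det_proj_cholPrec`, `abs_det_proj_cholPrec_inv`). Openness follows from the inverse function
theorem, and the quotient of the determinants is the Jacobian of the transition map because `D i =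
det Σ_fa(i) / det Σ_pa(i)` (`det_sub_fa_cholPrec_inv`).

The density is the change of variables along the covariance chart
(`invWishartInc_eq_densityMeasure`). Total mass one comes from completing the square in each column
of `L` (`trace_cholPrec_mul`): a Gaussian integral over `L` leaves a product of inverse gamma
integrals over `D` (`wishartChol_univ`). -/

/-- The kernel that sends `z` to the law of `e - c z`, where `e` has law `ν`. -/
noncomputable def translationKernel (ν : Measure ℝ) (c : γ → ℝ) : Kernel γ ℝ :=
  (Kernel.id ×ₖ Kernel.const γ ν).map fun q => q.2 - c q.1

instance (ν : Measure ℝ) [IsFiniteMeasure ν] (c : γ → ℝ) :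
    IsFiniteKernel (translationKernel ν c) := by
  unfold translationKernel; infer_instance

lemma translationKernel_apply (ν : Measure ℝ) [IsFiniteMeasure ν] {c : γ → ℝ} (hc : Measurable c)
    (z : γ) : translationKernel ν c z = ν.map fun e => e - c z := by
  have hm : Measurable fun q : γ × ℝ => q.2 - c q.1 := by fun_prop
  rw [translationKernel, Kernel.map_apply _ hm, Kernel.prod_apply, Kernel.id_apply,
    Kernel.const_apply, Measure.dirac_prod, Measure.map_map hm (by fun_prop)]
  rfl

/-- Turns a claim about conditional laws into one about a product measure pushed along a shear,
which is invertible. -/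
lemma compProd_translationKernel (ρ : Measure γ) [IsFiniteMeasure ρ] (ν : Measure ℝ)
    [IsFiniteMeasure ν] {c : γ → ℝ} (hc : Measurable c) :
    ρ ⊗ₘ translationKernel ν c = (ρ.prod ν).map fun q => (q.1, q.2 - c q.1) := by
  have hm : Measurable fun q : γ × ℝ => (q.1, q.2 - c q.1) := by fun_prop
  ext s hs
  rw [Measure.compProd_apply hs, Measure.map_apply hm hs, Measure.prod_apply (hm hs)]
  refine lintegral_congr fun z => ?_
  rw [translationKernel_apply ν hc, Measure.map_apply (by fun_prop) (measurable_prodMk_left hs)]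
  rfl

variable {Ω : Type*} [MeasurableSpace Ω] {μ : Measure Ω} [IsProbabilityMeasure μ]

/-- The residual `Y + c(W)` is independent of `W` iff the conditional law of `Y` given `W` is a
translate of the law of the residual. -/
lemma indepFun_add_iff_condDistrib {W : Ω → γ} {Y : Ω → ℝ} {c : γ → ℝ} (hW : Measurable W)
    (hY : Measurable Y) (hc : Measurable c) :
    IndepFun (fun ω => Y ω + c (W ω)) W μ ↔
      condDistrib Y W μ =ᵐ[μ.map W] translationKernel (μ.map fun ω => Y ω + c (W ω)) c := by
  have hε : Measurable fun ω => Y ω + c (W ω) := by fun_prop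
  have : IsProbabilityMeasure (μ.map fun ω => Y ω + c (W ω)) :=
    Measure.isProbabilityMeasure_map hε.aemeasurable
  have : IsProbabilityMeasure (μ.map W) := Measure.isProbabilityMeasure_map hW.aemeasurable
  rw [condDistrib_ae_eq_iff_measure_eq_compProd _ hY.aemeasurable,
    compProd_translationKernel _ _ hc,
    show IndepFun (fun ω => Y ω + c (W ω)) W μ ↔ IndepFun W (fun ω => Y ω + c (W ω)) μ from
      ⟨fun h => h.symm, fun h => h.symm⟩,
    indepFun_iff_map_prod_eq_prod_map_map hW.aemeasurable hε.aemeasurable]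
  have hs : Measurable fun q : γ × ℝ => (q.1, q.2 - c q.1) := by fun_prop
  have hs' : Measurable fun q : γ × ℝ => (q.1, q.2 + c q.1) := by fun_prop
  constructor
  · intro h
    rw [← h, Measure.map_map hs (by fun_prop)]
    congr 1
    ext ω <;> simp
  · intro h
    have h' := congrArg (Measure.map fun q : γ × ℝ => (q.1, q.2 + c q.1)) h
    rw [Measure.map_map hs' (by fun_prop), Measure.map_map hs' hs] at h'
    convert! h' using 1
    convert! Measure.map_id.symm using 2
    ext q <;> simp

variable [StandardBorelSpace Ω] [StandardBorelSpace β] [Nonempty β]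

/-- If the residual `Y + c(Z)` is independent of `Z`, then `Y` and `X` are conditionally
independent given `Z` iff the residual is independent of `(Z, X)`. -/
lemma condIndepFun_iff_indepFun_residual {X : Ω → β} {Y : Ω → ℝ} {Z : Ω → γ} {c : γ → ℝ}
    (hX : Measurable X) (hY : Measurable Y) (hZ : Measurable Z) (hc : Measurable c)
    (hind : IndepFun (fun ω => Y ω + c (Z ω)) Z μ) :
    CondIndepFun (MeasurableSpace.comap Z inferInstance) hZ.comap_le Y X μ ↔
      IndepFun (fun ω => Y ω + c (Z ω)) (fun ω => (Z ω, X ω)) μ := by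
  have hε : Measurable fun ω => Y ω + c (Z ω) := by fun_prop
  set ν := μ.map fun ω => Y ω + c (Z ω) with hν
  have : IsProbabilityMeasure ν := Measure.isProbabilityMeasure_map hε.aemeasurable
  have h1 := (indepFun_add_iff_condDistrib hZ hY hc).1 hind
  have h2 := indepFun_add_iff_condDistrib (μ := μ) (W := fun ω => (Z ω, X ω)) (c := fun q => c q.1)
    (hZ.prodMk hX) hY (by fun_prop)
  rw [h2]
  -- The criterion below describes the conditional law of the second variable, which has to be the
  -- real-valued `Y`.
  have hcomm : CondIndepFun (MeasurableSpace.comap Z inferInstance) hZ.comap_le Y X μ ↔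
      CondIndepFun (MeasurableSpace.comap Z inferInstance) hZ.comap_le X Y μ :=
    ⟨fun h => h.symm, fun h => h.symm⟩
  rw [hcomm, condIndepFun_iff_condDistrib_prod_ae_eq_prodMkRight hY hX hZ]
  have h3 : (condDistrib Y Z μ).prodMkRight β =ᵐ[μ.map fun ω => (Z ω, X ω)]
      translationKernel ν fun q : γ × β => c q.1 := by
    have hmap : (μ.map fun ω => (Z ω, X ω)).map Prod.fst = μ.map Z := by
      rw [Measure.map_map measurable_fst (hZ.prodMk hX)]; rfl
    rw [← hmap] at h1
    filter_upwards [ae_of_ae_map measurable_fst.aemeasurable h1] with q hq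
    rw [Kernel.prodMkRight_apply, hq, translationKernel_apply _ hc,
      translationKernel_apply _ (by fun_prop)]
  exact ⟨fun h => h.trans h3, fun h => h.trans h3.symm⟩

end ProbabilityTheory

/-! ### The Markov property in terms of the covariance matrix -/

section Gaussian

variable {p : ℕ} {S : Matrix (Fin p) (Fin p) ℝ}

lemma covariance_dotProduct_multivariateGaussian (hS : S.PosSemidef) (v : Fin p → ℝ) (k : Fin p) :
    cov[fun x : EuclideanSpace ℝ (Fin p) => ∑ j, v j * x j, fun x => x k;
      multivariateGaussian 0 S] = (v ᵥ* S) k := by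
  have hG : HasGaussianLaw (fun x : EuclideanSpace ℝ (Fin p) => x) (multivariateGaussian 0 S) :=
    IsGaussian.hasGaussianLaw_id
  have hm (j : Fin p) : MemLp (fun x : EuclideanSpace ℝ (Fin p) => x j) 2
      (multivariateGaussian 0 S) :=
    (hG.map_fun (EuclideanSpace.proj j : EuclideanSpace ℝ (Fin p) →L[ℝ] ℝ)).memLp_two
  rw [covariance_fun_sum_left (fun j => (hm j).const_mul _) (hm k)]
  simp only [covariance_const_mul_left, covariance_eval_multivariateGaussian hS, Matrix.vecMul,
    dotProduct]

/-- Jointly Gaussian variables are independent as soon as their covariances vanish, and here these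
are entries of `v ᵥ* S`. -/
lemma indepFun_dotProduct_coords_iff (hS : S.PosSemidef) (v : Fin p → ℝ) (a : Finset (Fin p)) :
    IndepFun (fun x : EuclideanSpace ℝ (Fin p) => ∑ j, v j * x j)
      (ParentOrderedDAG.coords a) (multivariateGaussian 0 S) ↔ ∀ k ∈ a, (v ᵥ* S) k = 0 := by
  have hG : HasGaussianLaw (fun x : EuclideanSpace ℝ (Fin p) => x) (multivariateGaussian 0 S) :=
    IsGaussian.hasGaussianLaw_id
  have hm (j : Fin p) : MemLp (fun x : EuclideanSpace ℝ (Fin p) => x j) 2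
      (multivariateGaussian 0 S) :=
    (hG.map_fun (EuclideanSpace.proj j : EuclideanSpace ℝ (Fin p) →L[ℝ] ℝ)).memLp_two
  constructor
  · intro h k hk
    rw [← covariance_dotProduct_multivariateGaussian hS]
    have he : Measurable fun y : a → ℝ => y ⟨k, hk⟩ := measurable_pi_apply _
    have h' := h.comp measurable_id he
    refine IndepFun.covariance_eq_zero h' ?_ (hm k)
    exact memLp_finsetSum _ fun j _ => (hm j).const_mul _
  · intro h
    -- The scalar is packaged as a family over `Unit`, since the covariance criterion compares two
    -- finite families.
    have hJ : HasGaussianLaw (fun x : EuclideanSpace ℝ (Fin p) =>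
        ((fun _ : Unit => ∑ j, v j * x j), fun j : a => x j)) (multivariateGaussian 0 S) := by
      let L : EuclideanSpace ℝ (Fin p) →L[ℝ] (Unit → ℝ) × (a → ℝ) :=
        (ContinuousLinearMap.pi fun _ => ∑ j, v j • EuclideanSpace.proj j).prod
          (ContinuousLinearMap.pi fun j => EuclideanSpace.proj j.1)
      convert! hG.map_fun L using 2 with x
      simp [L]
    have := hJ.indepFun_of_covariance_eval fun _ j => by
      rw [covariance_dotProduct_multivariateGaussian hS]; exact h j j.2
    exact this.comp (φ := fun y : Unit → ℝ => y ()) (ψ := id) (by fun_prop) measurable_id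

end Gaussian

namespace ParentOrderedDAG

variable {p : ℕ} (D : ParentOrderedDAG p)

lemma mem_pa {i j : Fin p} : j ∈ D.pa i ↔ D.Adj j i := by simp [pa]

lemma mem_nonpa {i j : Fin p} : j ∈ D.nonpa i ↔ i < j ∧ ¬ D.Adj j i := by simp [nonpa, mem_pa]

lemma lt_of_mem_pa {i j : Fin p} (h : j ∈ D.pa i) : i < j := D.lt_of_adj _ _ (D.mem_pa.1 h)

lemma notMem_pa_self (i : Fin p) : i ∉ D.pa i := fun h => (D.lt_of_mem_pa h).false

lemma lowerMatrix_diag (l : D.Arrow → ℝ) (i : Fin p) : D.lowerMatrix l i i = 1 := by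
  simp [lowerMatrix]

lemma lowerMatrix_adj (l : D.Arrow → ℝ) {i j : Fin p} (h : D.Adj i j) :
    D.lowerMatrix l i j = l ⟨(i, j), h⟩ := by
  have := D.lt_of_adj _ _ h
  simp [lowerMatrix, h, this.ne']

lemma lowerMatrix_of_not_adj (l : D.Arrow → ℝ) {i j : Fin p} (hij : i ≠ j) (h : ¬ D.Adj i j) :
    D.lowerMatrix l i j = 0 := by
  simp [lowerMatrix, h, hij]

lemma lowerMatrix_of_lt (l : D.Arrow → ℝ) {i j : Fin p} (hij : i < j) :
    D.lowerMatrix l i j = 0 :=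
  D.lowerMatrix_of_not_adj l hij.ne fun h => (D.lt_of_adj _ _ h).not_gt hij

/-- A sum over a column of the lower triangular matrix is a sum over the family of the column. -/
lemma sum_lowerMatrix_mul (l : D.Arrow → ℝ) (i : Fin p) (f : Fin p → ℝ) :
    ∑ j, D.lowerMatrix l j i * f j =
      f i + ∑ j : D.pa i, l ⟨(j, i), D.mem_pa.1 j.2⟩ * f j := by
  classical
  have h1 : ∑ j ∈ insert i (D.pa i), D.lowerMatrix l j i * f j =
      ∑ j, D.lowerMatrix l j i * f j := by
    refine Finset.sum_subset (Finset.subset_univ _) fun j _ hj => ?_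
    rw [Finset.mem_insert, not_or, D.mem_pa] at hj
    rw [D.lowerMatrix_of_not_adj l hj.1 hj.2, zero_mul]
  rw [← h1, Finset.sum_insert (D.notMem_pa_self i), D.lowerMatrix_diag, one_mul,
    ← Finset.sum_coe_sort]
  congr 1
  refine Finset.sum_congr rfl fun j _ => ?_
  rw [D.lowerMatrix_adj l (D.mem_pa.1 j.2)]

lemma transpose_lowerMatrix_mul_apply (l : D.Arrow → ℝ) (S : Matrix (Fin p) (Fin p) ℝ)
    (i k : Fin p) : ((D.lowerMatrix l)ᵀ * S) i k =
      S i k + ∑ j : D.pa i, l ⟨(j, i), D.mem_pa.1 j.2⟩ * S j k := by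
  rw [← D.sum_lowerMatrix_mul l i fun j => S j k]
  simp [Matrix.mul_apply]

lemma sub_posDef {S : Matrix (Fin p) (Fin p) ℝ} (hS : S.PosDef) (a : Finset (Fin p)) :
    (sub S a).PosDef := hS.submatrix Subtype.val_injective

/-- The regression coefficients of every vertex on its parents. -/
lemma exists_regression {S : Matrix (Fin p) (Fin p) ℝ} (hS : S.PosDef) :
    ∃ l : D.Arrow → ℝ, ∀ i, ∀ k ∈ D.pa i, ((D.lowerMatrix l)ᵀ * S) i k = 0 := by
  -- Column `i` of `L` carries minus the coefficients `S_pa⁻¹ S_{pa,i}`, so that row `i` of `Lᵀ x`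
  -- is the regression residual.
  refine ⟨fun e => -((sub S (D.pa e.1.2))⁻¹ *ᵥ fun k => S e.1.2 k) ⟨e.1.1, D.mem_pa.2 e.2⟩,
    fun i k hk => ?_⟩
  rw [D.transpose_lowerMatrix_mul_apply]
  set w : D.pa i → ℝ := (sub S (D.pa i))⁻¹ *ᵥ (fun k => S i k) with hw
  have hdet : IsUnit (sub S (D.pa i)).det := (sub_posDef hS _).det_pos.ne'.isUnit
  have h := congrFun (show sub S (D.pa i) *ᵥ w = (fun k : D.pa i => S i k) by
    rw [hw, Matrix.mulVec_mulVec, Matrix.mul_nonsing_inv _ hdet, Matrix.one_mulVec]) ⟨k, hk⟩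
  simp only [Matrix.mulVec, dotProduct, sub, Matrix.submatrix_apply] at h
  rw [← h, ← Finset.sum_add_distrib]
  refine Finset.sum_eq_zero fun j _ => ?_
  have hsymm : S j k = S k j := by simpa using hS.isHermitian.apply k j
  simp [hsymm, w]
  ring

/-- For a positive definite covariance matrix the Markov property says that `Lᵀ S` is lower
triangular for some unit lower triangular `L` supported on the graph. -/
lemma isMarkov_iff {S : Matrix (Fin p) (Fin p) ℝ} (hS : S.PosDef) :
    D.IsMarkov S ↔ ∃ l : D.Arrow → ℝ, ∀ i k, i < k → ((D.lowerMatrix l)ᵀ * S) i k = 0 := by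
  -- Orthogonality to the parents alone makes `l` a regression. The Markov condition at `i` then
  -- extends this orthogonality to every larger label.
  have key (l : D.Arrow → ℝ) (hl : ∀ i, ∀ k ∈ D.pa i, ((D.lowerMatrix l)ᵀ * S) i k = 0)
      (i : Fin p) :
      CondIndepFun (MeasurableSpace.comap (coords (D.pa i)) inferInstance)
        (measurable_coords (D.pa i)).comap_le
        (fun x : EuclideanSpace ℝ (Fin p) => x i) (coords (D.nonpa i))
        (multivariateGaussian 0 S) ↔ ∀ k, i < k → ((D.lowerMatrix l)ᵀ * S) i k = 0 := by
    set v : Fin p → ℝ := fun j => D.lowerMatrix l j i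
    have hv (k) : ((D.lowerMatrix l)ᵀ * S) i k = (v ᵥ* S) k := by
      simp [Matrix.mul_apply, Matrix.vecMul, dotProduct, v]
    set c : (D.pa i → ℝ) → ℝ := fun y => ∑ j : D.pa i, l ⟨(j, i), D.mem_pa.1 j.2⟩ * y j
    have hε : (fun x : EuclideanSpace ℝ (Fin p) => x i + c (coords (D.pa i) x)) =
        fun x => ∑ j, v j * x j := by
      ext x
      exact (D.sum_lowerMatrix_mul l i fun j => x j).symm
    have hind : IndepFun (fun x : EuclideanSpace ℝ (Fin p) => x i + c (coords (D.pa i) x))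
        (coords (D.pa i)) (multivariateGaussian 0 S) := by
      rw [hε, indepFun_dotProduct_coords_iff hS.posSemidef]
      exact fun k hk => by rw [← hv]; exact hl i k hk
    rw [condIndepFun_iff_indepFun_residual (measurable_coords _) (by fun_prop)
      (measurable_coords _) (by fun_prop) hind, hε]
    simp only [hv]
    constructor
    · intro h k hk
      by_cases hkp : k ∈ D.pa i
      · rw [← hv]; exact hl i k hkp
      · have h' := h.comp (φ := id) measurable_id measurable_snd
        exact (indepFun_dotProduct_coords_iff hS.posSemidef v (D.nonpa i)).1 h' k
          (D.mem_nonpa.2 ⟨hk, fun h => hkp (D.mem_pa.2 h)⟩)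
    · intro h
      -- Independence of all later coordinates at once gives joint independence of parents and
      -- non-parents, by selecting coordinates.
      have h' := (indepFun_dotProduct_coords_iff hS.posSemidef v (Finset.Ioi i)).2
        fun k hk => h k (Finset.mem_Ioi.1 hk)
      exact h'.comp (φ := id) (ψ := fun y : Finset.Ioi i → ℝ =>
        ((fun j : D.pa i => y ⟨j, Finset.mem_Ioi.2 (D.lt_of_mem_pa j.2)⟩),
          fun j : D.nonpa i => y ⟨j, Finset.mem_Ioi.2 (D.mem_nonpa.1 j.2).1⟩))
        measurable_id (by fun_prop)
  constructor
  · intro h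
    obtain ⟨l, hl⟩ := D.exists_regression hS
    exact ⟨l, fun i => (key l hl i).1 (h i)⟩
  · rintro ⟨l, hl⟩ i
    exact (key l (fun i k hk => hl i k (D.lt_of_mem_pa hk)) i).2 (hl i)

end ParentOrderedDAG

/-! ### The Cholesky parametrization of the covariance matrices -/

namespace ParentOrderedDAG

variable {p : ℕ} (D : ParentOrderedDAG p)

lemma blockTriangular_lowerMatrix (l : D.Arrow → ℝ) :
    (D.lowerMatrix l).BlockTriangular OrderDual.toDual :=
  fun _ _ h => D.lowerMatrix_of_lt l (OrderDual.toDual_lt_toDual.1 h)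

lemma det_lowerMatrix (l : D.Arrow → ℝ) : (D.lowerMatrix l).det = 1 := by
  rw [Matrix.det_of_isLowerTriangular _ (D.blockTriangular_lowerMatrix l)]
  simp [D.lowerMatrix_diag]

lemma isUnit_det_lowerMatrix (l : D.Arrow → ℝ) : IsUnit (D.lowerMatrix l).det := by
  simp [D.det_lowerMatrix]

lemma inv_diagonal_of_pos {d : Fin p → ℝ} (hd : ∀ i, 0 < d i) :
    (Matrix.diagonal d)⁻¹ = Matrix.diagonal fun i => (d i)⁻¹ := by
  refine Matrix.inv_eq_right_inv ?_
  rw [Matrix.diagonal_mul_diagonal, ← Matrix.diagonal_one]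
  congr 1
  ext i
  exact mul_inv_cancel₀ (hd i).ne'

lemma cholPrec_eq {t : D.CholCoord} (ht : t ∈ D.chol) :
    D.cholPrec t = D.lowerMatrix t.2 * Matrix.diagonal (fun i => (t.1 i)⁻¹)
      * (D.lowerMatrix t.2)ᵀ := by
  rw [cholPrec, inv_diagonal_of_pos ht]

lemma cholPrec_posDef {t : D.CholCoord} (ht : t ∈ D.chol) : (D.cholPrec t).PosDef := by
  rw [D.cholPrec_eq ht]
  have h : (Matrix.diagonal fun i => (t.1 i)⁻¹).PosDef :=
    Matrix.PosDef.diagonal fun i => inv_pos.2 (ht i)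
  have hinj : Function.Injective ((D.lowerMatrix t.2).vecMul) :=
    Matrix.vecMul_injective_of_isUnit
      ((Matrix.isUnit_iff_isUnit_det _).2 (D.isUnit_det_lowerMatrix _))
  simpa using h.mul_mul_conjTranspose_same hinj

lemma cholPrec_inv_posDef {t : D.CholCoord} (ht : t ∈ D.chol) : (D.cholPrec t)⁻¹.PosDef :=
  (D.cholPrec_posDef ht).inv

lemma isUnit_det_cholPrec {t : D.CholCoord} (ht : t ∈ D.chol) : IsUnit (D.cholPrec t).det :=
  (D.cholPrec_posDef ht).det_pos.ne'.isUnit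

/-- Since `Σ = L⁻ᵀ D L⁻¹`, one factor cancels. The right side is visibly lower triangular with
diagonal `D`, which is how `Lᵀ Σ` enters everything below. -/
lemma transpose_lowerMatrix_mul_inv {t : D.CholCoord} (ht : t ∈ D.chol) :
    (D.lowerMatrix t.2)ᵀ * (D.cholPrec t)⁻¹ =
      Matrix.diagonal t.1 * (D.lowerMatrix t.2)⁻¹ := by
  have hL := D.isUnit_det_lowerMatrix t.2
  have hd : (Matrix.diagonal t.1).det ≠ 0 := by
    rw [Matrix.det_diagonal]
    exact (Finset.prod_pos fun i _ => ht i).ne'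
  rw [cholPrec, Matrix.mul_inv_rev, Matrix.mul_inv_rev, ← Matrix.mul_assoc,
    Matrix.mul_nonsing_inv _ (by simpa using hL), Matrix.one_mul,
    Matrix.nonsing_inv_nonsing_inv _ hd.isUnit]

lemma inv_lowerMatrix_of_lt (l : D.Arrow → ℝ) {i k : Fin p} (h : i < k) :
    (D.lowerMatrix l)⁻¹ i k = 0 := by
  let := Matrix.invertibleOfIsUnitDet _ (D.isUnit_det_lowerMatrix l)
  exact Matrix.blockTriangular_inv_of_blockTriangular (D.blockTriangular_lowerMatrix l)
    (OrderDual.toDual_lt_toDual.2 h)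

lemma inv_lowerMatrix_diag (l : D.Arrow → ℝ) (i : Fin p) : (D.lowerMatrix l)⁻¹ i i = 1 := by
  have h := congrFun (congrFun (Matrix.mul_nonsing_inv _ (D.isUnit_det_lowerMatrix l)) i) i
  rw [Matrix.mul_apply, Finset.sum_eq_single i, D.lowerMatrix_diag, one_mul] at h
  · simpa using h
  · intro j _ hj
    rcases lt_or_gt_of_ne hj with h | h
    · rw [D.inv_lowerMatrix_of_lt l h, mul_zero]
    · rw [D.lowerMatrix_of_lt l h, zero_mul]
  · simp

/-- The matrix `Lᵀ Σ` is lower triangular. -/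
lemma transpose_mul_inv_of_lt {t : D.CholCoord} (ht : t ∈ D.chol) {i k : Fin p} (h : i < k) :
    ((D.lowerMatrix t.2)ᵀ * (D.cholPrec t)⁻¹) i k = 0 := by
  rw [D.transpose_lowerMatrix_mul_inv ht, Matrix.diagonal_mul, D.inv_lowerMatrix_of_lt _ h,
    mul_zero]

lemma transpose_mul_inv_diag {t : D.CholCoord} (ht : t ∈ D.chol) (i : Fin p) :
    ((D.lowerMatrix t.2)ᵀ * (D.cholPrec t)⁻¹) i i = t.1 i := by
  rw [D.transpose_lowerMatrix_mul_inv ht, Matrix.diagonal_mul, D.inv_lowerMatrix_diag, mul_one]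

/-- The covariance matrices of the Gaussian DAG model are exactly the inverses of the matrices
`L D⁻¹ Lᵀ`. -/
lemma covSpace_eq_image : D.covSpace = (fun t => (D.cholPrec t)⁻¹) '' D.chol := by
  ext S
  constructor
  · rintro ⟨hS, hM⟩
    obtain ⟨l, hl⟩ := (D.isMarkov_iff hS).1 hM
    set L := D.lowerMatrix l with hLdef
    have hL : IsUnit L.det := D.isUnit_det_lowerMatrix l
    -- As a product of the lower triangular `Lᵀ S` and `L`, this matrix is lower triangular; being
    -- symmetric it is diagonal, and its diagonal is the required `D`.
    set M := Lᵀ * S * L with hMdef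
    have hMpos : M.PosDef := by
      have hinj : Function.Injective L.mulVec :=
        Matrix.mulVec_injective_of_isUnit ((Matrix.isUnit_iff_isUnit_det _).2 hL)
      simpa using hS.conjTranspose_mul_mul_same hinj
    have hMlt (i k : Fin p) (h : i < k) : M i k = 0 := by
      rw [hMdef, Matrix.mul_apply]
      refine Finset.sum_eq_zero fun j _ => ?_
      rcases lt_or_ge i j with hj | hj
      · rw [hl i j hj, zero_mul]
      · rw [hLdef, D.lowerMatrix_of_lt l (hj.trans_lt h), mul_zero]
    have hMdiag : M = Matrix.diagonal fun i => M i i := by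
      ext i k
      rcases lt_trichotomy i k with h | rfl | h
      · rw [hMlt i k h, Matrix.diagonal_apply_ne _ h.ne]
      · rw [Matrix.diagonal_apply_eq]
      · have := hMpos.isHermitian.apply i k
        rw [hMlt k i h] at this
        rw [Matrix.diagonal_apply_ne _ h.ne', ← this]
        simp
    have hpos : ∀ i, 0 < M i i := fun i => hMpos.diag_pos
    refine ⟨(fun i => M i i, l), hpos, ?_⟩
    refine Matrix.inv_eq_left_inv ?_
    have h1 : Lᵀ * S = M * L⁻¹ := by
      rw [hMdef, Matrix.mul_assoc _ L, Matrix.mul_nonsing_inv _ hL, Matrix.mul_one]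
    rw [cholPrec, ← hLdef, ← hMdiag]
    have h2 : S * (L * M⁻¹ * Lᵀ) = 1 := by
      have hS' : S = Lᵀ⁻¹ * M * L⁻¹ := by
        rw [Matrix.mul_assoc, ← h1, ← Matrix.mul_assoc,
          Matrix.nonsing_inv_mul _ (by simpa using hL), Matrix.one_mul]
      have hMu : IsUnit M.det := hMpos.det_pos.ne'.isUnit
      rw [hS']
      calc Lᵀ⁻¹ * M * L⁻¹ * (L * M⁻¹ * Lᵀ) = Lᵀ⁻¹ * (M * ((L⁻¹ * L) * M⁻¹)) * Lᵀ := by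
            simp only [Matrix.mul_assoc]
        _ = 1 := by
          rw [Matrix.nonsing_inv_mul _ hL, Matrix.one_mul, Matrix.mul_nonsing_inv _ hMu,
            Matrix.mul_one, Matrix.nonsing_inv_mul _ (by simpa using hL)]
    exact h2
  · rintro ⟨t, ht, rfl⟩
    have hS := D.cholPrec_inv_posDef ht
    exact ⟨hS, (D.isMarkov_iff hS).2 ⟨t.2, fun i k h => D.transpose_mul_inv_of_lt ht h⟩⟩

lemma precSpace_eq_image : D.precSpace = D.cholPrec '' D.chol := by
  rw [precSpace, covSpace_eq_image, image_image]
  refine image_congr fun t ht => ?_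
  exact Matrix.nonsing_inv_nonsing_inv _ (D.isUnit_det_cholPrec ht)

/-! ### Uniqueness of completions -/

lemma proj_eq_iff {A B : Matrix (Fin p) (Fin p) ℝ} :
    D.proj A = D.proj B ↔ (∀ i, A i i = B i i) ∧ ∀ i, ∀ j ∈ D.pa i, A j i = B j i := by
  constructor
  · intro h
    exact ⟨fun i => congrFun h ⟨(i, i), Or.inl rfl⟩,
      fun i j hj => congrFun h ⟨(j, i), Or.inr (D.mem_pa.1 hj)⟩⟩
  · rintro ⟨h1, h2⟩
    ext ⟨⟨a, b⟩, h | h⟩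
    · obtain rfl : a = b := h
      exact h1 a
    · exact h2 b a (D.mem_pa.2 h)

/-- A covariance matrix of the model and its regression coefficients are determined by the entries
at the edges. -/
lemma eq_of_proj_eq {S S' : Matrix (Fin p) (Fin p) ℝ} (hS : S.PosDef) (hS' : S'.PosDef)
    {l l' : D.Arrow → ℝ} (hl : ∀ i k, i < k → ((D.lowerMatrix l)ᵀ * S) i k = 0)
    (hl' : ∀ i k, i < k → ((D.lowerMatrix l')ᵀ * S') i k = 0) (h : D.proj S = D.proj S') :
    S = S' ∧ l = l' := by
  rw [D.proj_eq_iff] at h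
  have hsym (a b) : S a b = S b a := by simpa using hS.isHermitian.apply b a
  have hsym' (a b) : S' a b = S' b a := by simpa using hS'.isHermitian.apply b a
  -- Downward recursion on the label. The block of later vertices is known, and the edges give `S i
  -- k` for parents `k`; the invertible system in `S_pa(i)` then yields column `i` of `L`. The zeros
  -- of `Lᵀ S` finally express the remaining entries of row `i` through later rows.
  have key : ∀ i : Fin p, (∀ k, i ≤ k → S i k = S' i k) ∧
      ∀ j : D.pa i, l ⟨(j, i), D.mem_pa.1 j.2⟩ = l' ⟨(j, i), D.mem_pa.1 j.2⟩ := by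
    intro i
    induction i using WellFoundedGT.induction with
    | ind i ih =>
    have hlater (a b : Fin p) (ha : i < a) (hb : i < b) : S a b = S' a b := by
      rcases le_total a b with hab | hab
      · exact (ih a ha).1 b hab
      · rw [hsym, hsym', (ih b hb).1 a hab]
    have hpa (k : Fin p) (hk : k ∈ D.pa i) : S i k = S' i k := by
      rw [hsym, hsym']; exact h.2 i k hk
    have hcoef : (fun j : D.pa i => l ⟨(j, i), D.mem_pa.1 j.2⟩) =
        fun j : D.pa i => l' ⟨(j, i), D.mem_pa.1 j.2⟩ := by
      have hu : IsUnit (sub S (D.pa i)) :=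
        (Matrix.isUnit_iff_isUnit_det _).2 (sub_posDef hS _).det_pos.ne'.isUnit
      refine Matrix.vecMul_injective_of_isUnit hu ?_
      ext k
      have e1 := hl i k (D.lt_of_mem_pa k.2)
      have e2 := hl' i k (D.lt_of_mem_pa k.2)
      rw [D.transpose_lowerMatrix_mul_apply] at e1 e2
      simp only [Matrix.vecMul, dotProduct, sub, Matrix.submatrix_apply]
      have e3 : ∑ j : D.pa i, l' ⟨(j, i), D.mem_pa.1 j.2⟩ * S j k =
          ∑ j : D.pa i, l' ⟨(j, i), D.mem_pa.1 j.2⟩ * S' j k :=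
        Finset.sum_congr rfl fun j _ => by
          rw [hlater j k (D.lt_of_mem_pa j.2) (D.lt_of_mem_pa k.2)]
      linarith [hpa k k.2]
    refine ⟨fun k hk => ?_, fun j => congrFun hcoef j⟩
    rcases hk.eq_or_lt with rfl | hk
    · exact h.1 i
    have e1 := hl i k hk
    have e2 := hl' i k hk
    rw [D.transpose_lowerMatrix_mul_apply] at e1 e2
    have e3 : ∑ j : D.pa i, l ⟨(j, i), D.mem_pa.1 j.2⟩ * S j k =
        ∑ j : D.pa i, l' ⟨(j, i), D.mem_pa.1 j.2⟩ * S' j k :=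
      Finset.sum_congr rfl fun j _ => by
        rw [hlater j k (D.lt_of_mem_pa j.2) hk, congrFun hcoef j]
    linarith
  refine ⟨?_, ?_⟩
  · ext a b
    rcases le_total a b with hab | hab
    · exact (key a).1 b hab
    · rw [hsym, hsym', (key b).1 a hab]
  · ext ⟨⟨a, b⟩, hab⟩
    exact (key b).2 ⟨a, D.mem_pa.2 hab⟩

/-- Once `Σ` and `L` are recovered, `D` is the diagonal of `Lᵀ Σ`. -/
lemma injOn_proj_cholPrec_inv : InjOn (fun t => D.proj (D.cholPrec t)⁻¹) D.chol := by
  intro t ht t' ht' h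
  obtain ⟨h1, h2⟩ := D.eq_of_proj_eq (D.cholPrec_inv_posDef ht) (D.cholPrec_inv_posDef ht')
    (fun i k hk => D.transpose_mul_inv_of_lt ht hk)
    (fun i k hk => D.transpose_mul_inv_of_lt ht' hk) h
  refine Prod.ext (funext fun i => ?_) h2
  rw [← D.transpose_mul_inv_diag ht, ← D.transpose_mul_inv_diag ht', h1, h2]

lemma injOn_proj_covSpace : InjOn D.proj D.covSpace := by
  rw [covSpace_eq_image]
  rintro _ ⟨t, ht, rfl⟩ _ ⟨t', ht', rfl⟩ h
  simp only [D.injOn_proj_cholPrec_inv ht ht' h]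

lemma cholPrec_apply {t : D.CholCoord} (ht : t ∈ D.chol) (k j : Fin p) :
    D.cholPrec t k j =
      ∑ m, D.lowerMatrix t.2 k m * D.lowerMatrix t.2 j m * (t.1 m)⁻¹ := by
  rw [D.cholPrec_eq ht, Matrix.mul_apply]
  refine Finset.sum_congr rfl fun m _ => ?_
  rw [Matrix.mul_diagonal, Matrix.transpose_apply]
  ring

/-- Columns after `j` drop out because `L j m = 0` for `m > j`. This isolates column `j` from the
earlier ones and makes upward recursion possible. -/
lemma cholPrec_apply_eq_sum_lt {t : D.CholCoord} (ht : t ∈ D.chol) (k j : Fin p) :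
    D.cholPrec t k j = D.lowerMatrix t.2 k j * (t.1 j)⁻¹ +
      ∑ m ∈ Finset.Iio j, D.lowerMatrix t.2 k m * D.lowerMatrix t.2 j m * (t.1 m)⁻¹ := by
  rw [D.cholPrec_apply ht]
  have h : ∑ m ∈ insert j (Finset.Iio j), D.lowerMatrix t.2 k m * D.lowerMatrix t.2 j m *
      (t.1 m)⁻¹ = ∑ m, D.lowerMatrix t.2 k m * D.lowerMatrix t.2 j m * (t.1 m)⁻¹ := by
    refine Finset.sum_subset (Finset.subset_univ _) fun m _ hm => ?_
    have : j < m := by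
      rw [Finset.mem_insert, Finset.mem_Iio, not_or, not_lt] at hm
      exact lt_of_le_of_ne hm.2 (Ne.symm hm.1)
    rw [D.lowerMatrix_of_lt _ this]
    ring
  rw [← h, Finset.sum_insert (by simp), D.lowerMatrix_diag, mul_one]

lemma injOn_proj_cholPrec : InjOn (fun t => D.proj (D.cholPrec t)) D.chol := by
  intro t ht t' ht' h
  replace h := D.proj_eq_iff.1 h
  -- Given the earlier columns, the loop at `j` determines `D j` and the arrows into `j` determine
  -- column `j` of `L`.
  have key : ∀ j, t.1 j = t'.1 j ∧ ∀ k, D.lowerMatrix t.2 k j = D.lowerMatrix t'.2 k j := by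
    intro j
    induction j using WellFoundedLT.induction with
    | ind j ih =>
    have hsum (k : Fin p) :
        ∑ m ∈ Finset.Iio j, D.lowerMatrix t.2 k m * D.lowerMatrix t.2 j m * (t.1 m)⁻¹ =
        ∑ m ∈ Finset.Iio j, D.lowerMatrix t'.2 k m * D.lowerMatrix t'.2 j m * (t'.1 m)⁻¹ := by
      refine Finset.sum_congr rfl fun m hm => ?_
      obtain ⟨h1, h2⟩ := ih m (Finset.mem_Iio.1 hm)
      rw [h1, h2, h2]
    have hd : t.1 j = t'.1 j := by
      have := h.1 j
      rw [D.cholPrec_apply_eq_sum_lt ht, D.cholPrec_apply_eq_sum_lt ht', hsum,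
        D.lowerMatrix_diag, D.lowerMatrix_diag] at this
      simpa using this
    refine ⟨hd, fun k => ?_⟩
    by_cases hkj : k = j
    · rw [hkj, D.lowerMatrix_diag, D.lowerMatrix_diag]
    by_cases hadj : D.Adj k j
    · have := h.2 j k (D.mem_pa.2 hadj)
      rw [D.cholPrec_apply_eq_sum_lt ht, D.cholPrec_apply_eq_sum_lt ht', hsum, hd,
        add_left_inj] at this
      exact mul_right_cancel₀ (inv_pos.2 (ht' j)).ne' this
    · rw [D.lowerMatrix_of_not_adj _ hkj hadj, D.lowerMatrix_of_not_adj _ hkj hadj]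
  refine Prod.ext (funext fun i => (key i).1) (funext fun ⟨⟨a, b⟩, hab⟩ => ?_)
  rw [← D.lowerMatrix_adj t.2 hab, ← D.lowerMatrix_adj t'.2 hab]
  exact (key b).2 a

lemma injOn_proj_precSpace : InjOn D.proj D.precSpace := by
  rw [precSpace_eq_image]
  rintro _ ⟨t, ht, rfl⟩ _ ⟨t', ht', rfl⟩ h
  simp only [D.injOn_proj_cholPrec ht ht' h]

/-! ### Determinants of principal submatrices -/

/-- The vertex `i` and its parents, as a disjoint union. -/
noncomputable def faEquiv (i : Fin p) : Unit ⊕ D.pa i ≃ D.fa i where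
  toFun := Sum.elim (fun _ => ⟨i, Finset.mem_insert_self _ _⟩)
    fun j => ⟨j, Finset.mem_insert_of_mem j.2⟩
  invFun k := if h : k.1 ∈ D.pa i then Sum.inr ⟨k, h⟩ else Sum.inl ()
  left_inv := by
    rintro (_ | j)
    · simp [D.notMem_pa_self]
    · simp
  right_inv := by
    rintro ⟨k, hk⟩
    by_cases h : k ∈ D.pa i
    · simp [h]
    · have : k = i := by
        rcases Finset.mem_insert.1 hk with h' | h'
        · exact h'
        · exact absurd h' h
      subst this
      simp [h]

/-- The determinant of a family in terms of that of the parents and a regression. -/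
lemma det_sub_fa (A : Matrix (Fin p) (Fin p) ℝ) (i : Fin p)
    (hA : IsUnit (sub A (D.pa i)).det) (v : D.pa i → ℝ)
    (hv : ∀ k : D.pa i, ∑ j : D.pa i, A k j * v j = -A k i) :
    (sub A (D.fa i)).det = (sub A (D.pa i)).det * (A i i + ∑ j : D.pa i, A i j * v j) := by
  rw [← Matrix.det_submatrix_equiv_self (D.faEquiv i)]
  have hblock : (sub A (D.fa i)).submatrix (D.faEquiv i) (D.faEquiv i) =
      Matrix.fromBlocks (Matrix.of fun _ _ : Unit => A i i)
        (Matrix.of fun (_ : Unit) (j : D.pa i) => A i j)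
        (Matrix.of fun (k : D.pa i) (_ : Unit) => A k i) (sub A (D.pa i)) := by
    ext (_ | a) (_ | b) <;> rfl
  let := Matrix.invertibleOfIsUnitDet _ hA
  -- Schur complement of the parents block. By `hv`, `-v` solves the linear system with matrix
  -- `A_pa(i)`, so the inverse disappears from the formula.
  rw [hblock, Matrix.det_fromBlocks₂₂]
  congr 1
  have hv' : ⅟(sub A (D.pa i)) * (Matrix.of fun (k : D.pa i) (_ : Unit) => A k i) =
      Matrix.of fun k _ => -v k := by
    have : (Matrix.of fun (k : D.pa i) (_ : Unit) => A k i) =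
        sub A (D.pa i) * Matrix.of fun (k : D.pa i) (_ : Unit) => -v k := by
      ext k _
      have h := hv k
      simp only [Matrix.mul_apply, sub, Matrix.submatrix_apply, Matrix.of_apply, mul_neg,
        Finset.sum_neg_distrib]
      rw [h, neg_neg]
    rw [this, ← Matrix.mul_assoc, invOf_mul_self, Matrix.one_mul]
  rw [Matrix.mul_assoc, hv', Matrix.det_unique]
  simp [Matrix.mul_apply]

/-- The zeros of `Lᵀ Σ` above the diagonal say that column `i` of `L` is the regression vector. The
Schur complement is then the diagonal entry of `Lᵀ Σ`, the conditional variance of `x i` given its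
parents. -/
lemma det_sub_fa_cholPrec_inv {t : D.CholCoord} (ht : t ∈ D.chol) (i : Fin p) :
    (sub (D.cholPrec t)⁻¹ (D.fa i)).det = (sub (D.cholPrec t)⁻¹ (D.pa i)).det * t.1 i := by
  have hS := D.cholPrec_inv_posDef ht
  have hsym (a b) : (D.cholPrec t)⁻¹ a b = (D.cholPrec t)⁻¹ b a := by
    simpa using hS.isHermitian.apply b a
  rw [D.det_sub_fa _ i (sub_posDef hS _).det_pos.ne'.isUnit
    fun j => t.2 ⟨(j, i), D.mem_pa.1 j.2⟩]
  · rw [← D.transpose_mul_inv_diag ht, D.transpose_lowerMatrix_mul_apply]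
    congr 2
    exact Finset.sum_congr rfl fun j _ => by rw [hsym, mul_comm]
  · intro k
    have h := D.transpose_mul_inv_of_lt ht (D.lt_of_mem_pa k.2)
    rw [D.transpose_lowerMatrix_mul_apply] at h
    have e : ∑ j : D.pa i, (D.cholPrec t)⁻¹ k j * t.2 ⟨(j, i), D.mem_pa.1 j.2⟩ =
        ∑ j : D.pa i, t.2 ⟨(j, i), D.mem_pa.1 j.2⟩ * (D.cholPrec t)⁻¹ j k :=
      Finset.sum_congr rfl fun j _ => by rw [hsym k, mul_comm]
    rw [e, hsym k i]
    linarith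

end ParentOrderedDAG

/-! ### Derivatives of the Cholesky parametrization -/

section NormedRing

variable {A E : Type*} [NormedRing A] [NormedAlgebra ℝ A] [CompleteSpace A]
  [NormedAddCommGroup E] [NormedSpace ℝ E]

lemma HasStrictFDerivAt.exists_ringInverse {f : E → A} {f' : E →L[ℝ] A} {x : E}
    (hf : HasStrictFDerivAt f f' x) (hu : IsUnit (f x)) :
    ∃ J : E →L[ℝ] A, HasStrictFDerivAt (fun y => Ring.inverse (f y)) J x ∧
      ∀ h, J h = -(Ring.inverse (f x) * f' h * Ring.inverse (f x)) := by
  obtain ⟨u, hu⟩ := hu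
  have h := hasStrictFDerivAt_ringInverse (𝕜 := ℝ) u
  rw [hu] at h
  exact ⟨_, h.comp x hf, fun v => by simp [← hu]⟩

lemma HasStrictFDerivAt.exists_mul_ringInverse_mul {l d t : E → A} {l' d' t' : E →L[ℝ] A} {x : E}
    (hl : HasStrictFDerivAt l l' x) (hd : HasStrictFDerivAt d d' x)
    (ht : HasStrictFDerivAt t t' x) (hu : IsUnit (d x)) :
    ∃ J : E →L[ℝ] A, HasStrictFDerivAt (fun y => l y * Ring.inverse (d y) * t y) J x ∧
      ∀ h, J h = l' h * Ring.inverse (d x) * t x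
        - l x * (Ring.inverse (d x) * d' h * Ring.inverse (d x)) * t x
        + l x * Ring.inverse (d x) * t' h := by
  obtain ⟨J, hJ, hJ'⟩ := hd.exists_ringInverse hu
  refine ⟨_, (hl.mul' hJ).mul' ht, fun h => ?_⟩
  simp [hJ', mul_assoc]
  abel

end NormedRing

namespace ParentOrderedDAG

open scoped Classical

variable {p : ℕ} (D : ParentOrderedDAG p)

/-- The Cholesky parameter with the given entries at the edges. -/
def edgeCoord (θ : D.IncMatrix) : D.CholCoord :=
  (fun i => θ ⟨(i, i), Or.inl rfl⟩, fun a => θ ⟨a.1, Or.inr a.2⟩)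

/-- The strictly lower triangular matrix with the given entries at the arrows. -/
noncomputable def strictLower : D.IncMatrix →ₗ[ℝ] Matrix (Fin p) (Fin p) ℝ where
  toFun θ := Matrix.of fun i j => if h : D.Adj i j then θ ⟨(i, j), Or.inr h⟩ else 0
  map_add' θ θ' := by ext i j; by_cases h : D.Adj i j <;> simp [h]
  map_smul' c θ := by ext i j; by_cases h : D.Adj i j <;> simp [h]

/-- The diagonal matrix with the given entries at the loops. -/
noncomputable def loopDiagonal : D.IncMatrix →ₗ[ℝ] Matrix (Fin p) (Fin p) ℝ where
  toFun θ := Matrix.diagonal fun i => θ ⟨(i, i), Or.inl rfl⟩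
  map_add' θ θ' := by simp [Matrix.diagonal_add]
  map_smul' c θ := by rw [RingHom.id_apply, ← Matrix.diagonal_smul]; rfl

lemma lowerMatrix_edgeCoord (θ : D.IncMatrix) :
    D.lowerMatrix (D.edgeCoord θ).2 = 1 + D.strictLower θ := by
  ext i j
  by_cases hij : i = j
  · subst hij
    have : ¬ D.Adj i i := fun h => (D.lt_of_adj _ _ h).false
    simp [lowerMatrix, strictLower, this]
  · simp [lowerMatrix, strictLower, edgeCoord, hij]

lemma cholPrec_edgeCoord (θ : D.IncMatrix) :
    D.cholPrec (D.edgeCoord θ) =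
      (1 + D.strictLower θ) * (D.loopDiagonal θ)⁻¹ * (1 + D.strictLower θ)ᵀ := by
  rw [cholPrec, lowerMatrix_edgeCoord]; rfl

/-- The differential of the precision matrix `L D⁻¹ Lᵀ`. -/
noncomputable def dCholPrec (θ h : D.IncMatrix) : Matrix (Fin p) (Fin p) ℝ :=
  D.strictLower h * (D.loopDiagonal θ)⁻¹ * (1 + D.strictLower θ)ᵀ
    - (1 + D.strictLower θ) * ((D.loopDiagonal θ)⁻¹ * D.loopDiagonal h * (D.loopDiagonal θ)⁻¹)
      * (1 + D.strictLower θ)ᵀ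
    + (1 + D.strictLower θ) * (D.loopDiagonal θ)⁻¹ * (D.strictLower h)ᵀ

-- The operator norm makes matrices a complete normed algebra, where the product rule and the rule
-- for inverses apply. It is needed only here: the statement mentions derivatives between spaces of
-- incomplete matrices alone.
open scoped Matrix.Norms.Operator in
lemma exists_hasStrictFDerivAt_proj {θ : D.IncMatrix} (hθ : D.edgeCoord θ ∈ D.chol) :
    (∃ J : D.IncMatrix →L[ℝ] D.IncMatrix,
      HasStrictFDerivAt (fun θ => D.proj (D.cholPrec (D.edgeCoord θ))) J θ ∧
      ∀ h, J h = D.proj (D.dCholPrec θ h)) ∧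
    ∃ J : D.IncMatrix →L[ℝ] D.IncMatrix,
      HasStrictFDerivAt (fun θ => D.proj (D.cholPrec (D.edgeCoord θ))⁻¹) J θ ∧
      ∀ h, J h = D.proj (-((D.cholPrec (D.edgeCoord θ))⁻¹ * D.dCholPrec θ h *
        (D.cholPrec (D.edgeCoord θ))⁻¹)) := by
  have hlin (f : D.IncMatrix →ₗ[ℝ] Matrix (Fin p) (Fin p) ℝ) :
      HasStrictFDerivAt (fun θ => f θ) f.toContinuousLinearMap θ :=
    f.toContinuousLinearMap.hasStrictFDerivAt
  have hL := (hlin D.strictLower).const_add 1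
  have hT : HasStrictFDerivAt (fun θ => (1 + D.strictLower θ)ᵀ) (((Matrix.transposeLinearEquiv
      (Fin p) (Fin p) ℝ ℝ).toLinearMap ∘ₗ D.strictLower).toContinuousLinearMap) θ := by
    refine ((hlin ((Matrix.transposeLinearEquiv (Fin p) (Fin p) ℝ ℝ).toLinearMap ∘ₗ
      D.strictLower)).const_add 1).congr_of_eventuallyEq (Filter.Eventually.of_forall fun η => ?_)
    simp [Matrix.transpose_add]
  have hu : IsUnit (D.loopDiagonal θ) := by
    rw [Matrix.isUnit_iff_isUnit_det]
    have : D.loopDiagonal θ = Matrix.diagonal fun i => θ ⟨(i, i), Or.inl rfl⟩ := rfl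
    rw [this, Matrix.det_diagonal]
    exact (Finset.prod_pos fun i _ => hθ i).ne'.isUnit
  obtain ⟨J, hJ, hJ'⟩ := hL.exists_mul_ringInverse_mul (hlin D.loopDiagonal) hT hu
  have hcongr : (fun θ => D.cholPrec (D.edgeCoord θ)) = fun η =>
      (1 + D.strictLower η) * Ring.inverse (D.loopDiagonal η) * (1 + D.strictLower η)ᵀ := by
    ext1 η
    rw [D.cholPrec_edgeCoord, Matrix.nonsing_inv_eq_ringInverse]
  rw [← hcongr] at hJ
  have hJd (h) : J h = D.dCholPrec θ h := by
    rw [hJ', dCholPrec, Matrix.nonsing_inv_eq_ringInverse]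
    rfl
  have hv : IsUnit (D.cholPrec (D.edgeCoord θ)) :=
    (Matrix.isUnit_iff_isUnit_det _).2 (D.isUnit_det_cholPrec hθ)
  obtain ⟨K, hK, hK'⟩ := hJ.exists_ringInverse hv
  have hent (e : D.Edge) (B) : HasStrictFDerivAt (fun B : Matrix (Fin p) (Fin p) ℝ => B e.1.1 e.1.2)
      (Matrix.entryLinearMap ℝ ℝ e.1.1 e.1.2).toContinuousLinearMap B :=
    (Matrix.entryLinearMap ℝ ℝ e.1.1 e.1.2).toContinuousLinearMap.hasStrictFDerivAt
  refine ⟨⟨_, hasStrictFDerivAt_pi.2 fun e : D.Edge => (hent e _).comp θ hJ, fun h => ?_⟩,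
    ⟨_, hasStrictFDerivAt_pi.2 fun e : D.Edge =>
      ((hent e _).comp θ hK).congr_of_eventuallyEq (Filter.Eventually.of_forall fun η => ?_),
      fun h => ?_⟩⟩
  · ext e
    rw [← hJd]
    rfl
  · simp only [Matrix.nonsing_inv_eq_ringInverse]
    rfl
  · ext e
    rw [← hJd, Matrix.nonsing_inv_eq_ringInverse, ← hK']
    rfl

/-! ### Determinants of matrices indexed by the edges -/

/-- The edges that point to `i`, the loop first. -/
def edgeTo (i : Fin p) : Unit ⊕ D.pa i → D.Edge :=
  Sum.elim (fun _ => ⟨(i, i), Or.inl rfl⟩) fun j => ⟨(j, i), Or.inr (D.mem_pa.1 j.2)⟩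

/-- The edges that point to `i` correspond to `i` and its parents. -/
noncomputable def edgeToEquiv (i : Fin p) : Unit ⊕ D.pa i ≃ {e : D.Edge // e.1.2 = i} :=
  Equiv.ofBijective (fun s => ⟨D.edgeTo i s, by rcases s with _ | j <;> rfl⟩) <| by
    constructor
    · rintro (_ | j) (_ | k) h
      · rfl
      · simp only [edgeTo, Sum.elim_inl, Sum.elim_inr, Subtype.mk.injEq, Prod.mk.injEq] at h
        exact absurd k.2 (by rw [← h.1]; exact D.notMem_pa_self i)
      · simp only [edgeTo, Sum.elim_inl, Sum.elim_inr, Subtype.mk.injEq, Prod.mk.injEq] at h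
        exact absurd j.2 (by rw [h.1]; exact D.notMem_pa_self i)
      · simp only [edgeTo, Sum.elim_inr, Subtype.mk.injEq, Prod.mk.injEq, and_true] at h
        exact congrArg Sum.inr (Subtype.ext h)
    · rintro ⟨⟨⟨a, b⟩, h⟩, rfl⟩
      by_cases hab : a = b
      · subst hab
        exact ⟨Sum.inl (), rfl⟩
      · exact ⟨Sum.inr ⟨a, D.mem_pa.2 (h.resolve_left hab)⟩, rfl⟩

/-- Edges are grouped by the vertex they point to, so block `i` is indexed by the loop at `i` and
its parents. No order inside a block is required. -/
lemma det_of_blockTriangular_edge (A : Matrix D.Edge D.Edge ℝ)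
    (hA : A.BlockTriangular fun e => e.1.2) :
    A.det = ∏ i, (A.submatrix (D.edgeTo i) (D.edgeTo i)).det := by
  rw [hA.det_fintype]
  refine Finset.prod_congr rfl fun i _ => ?_
  rw [← Matrix.det_submatrix_equiv_self (D.edgeToEquiv i)]
  rfl

lemma edge_cases {P : D.Edge → Prop} (loop : ∀ i, P (D.edgeTo i (Sum.inl ())))
    (arrow : ∀ i j, P (D.edgeTo i (Sum.inr j))) (e : D.Edge) : P e := by
  obtain ⟨s, hs⟩ := (D.edgeToEquiv e.1.2).surjective ⟨e, rfl⟩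
  have hs' : D.edgeTo e.1.2 s = e := congrArg Subtype.val hs
  rw [← hs']
  rcases s with _ | j
  · exact loop _
  · exact arrow _ _

/-! ### Partial derivatives of the precision matrix along the edges -/

lemma strictLower_single_loop (b : Fin p) :
    D.strictLower (Pi.single (D.edgeTo b (Sum.inl ())) 1) = 0 := by
  ext i j
  by_cases h : D.Adj i j
  · have hij := (D.lt_of_adj _ _ h).ne'
    have : (⟨(i, j), Or.inr h⟩ : D.Edge) ≠ D.edgeTo b (Sum.inl ()) := by
      rintro h'
      simp only [edgeTo, Sum.elim_inl, Subtype.mk.injEq, Prod.mk.injEq] at h'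
      exact hij (h'.1.trans h'.2.symm)
    simp [strictLower, h, this]
  · simp [strictLower, h]

lemma strictLower_single_arrow (b : Fin p) (a : D.pa b) :
    D.strictLower (Pi.single (D.edgeTo b (Sum.inr a)) 1) = Matrix.single a.1 b 1 := by
  ext i j
  by_cases hij : i = a ∧ j = b
  · obtain ⟨rfl, rfl⟩ := hij
    simp [strictLower, D.mem_pa.1 a.2, edgeTo]
  · have hz : Matrix.single a.1 b (1 : ℝ) i j = 0 := by
      rw [Matrix.single_apply, if_neg]
      rintro ⟨rfl, rfl⟩
      exact hij ⟨rfl, rfl⟩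
    rw [hz]
    by_cases h : D.Adj i j
    · have : (⟨(i, j), Or.inr h⟩ : D.Edge) ≠ D.edgeTo b (Sum.inr a) := by
        rintro h'
        simp only [edgeTo, Sum.elim_inr, Subtype.mk.injEq, Prod.mk.injEq] at h'
        exact hij h'
      simp [strictLower, h, this]
    · simp [strictLower, h]

lemma loopDiagonal_single_loop (b : Fin p) :
    D.loopDiagonal (Pi.single (D.edgeTo b (Sum.inl ())) 1) = Matrix.single b b 1 := by
  rw [← Matrix.diagonal_single]
  simp only [loopDiagonal, LinearMap.coe_mk, AddHom.coe_mk]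
  congr 1
  ext i
  by_cases h : i = b
  · subst h; simp [edgeTo]
  · have : (⟨(i, i), Or.inl rfl⟩ : D.Edge) ≠ D.edgeTo b (Sum.inl ()) := by
      rintro h'
      simp only [edgeTo, Sum.elim_inl, Subtype.mk.injEq, Prod.mk.injEq] at h'
      exact h h'.1
    simp [this, h]

lemma loopDiagonal_single_arrow (b : Fin p) (a : D.pa b) :
    D.loopDiagonal (Pi.single (D.edgeTo b (Sum.inr a)) 1) = 0 := by
  rw [← Matrix.diagonal_zero]
  simp only [loopDiagonal, LinearMap.coe_mk, AddHom.coe_mk]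
  congr 1
  ext i
  have : (⟨(i, i), Or.inl rfl⟩ : D.Edge) ≠ D.edgeTo b (Sum.inr a) := by
    rintro h'
    simp only [edgeTo, Sum.elim_inr, Subtype.mk.injEq, Prod.mk.injEq] at h'
    have h := D.lt_of_mem_pa a.2
    rw [← h'.1, ← h'.2] at h
    exact h.false
  simp [this]

lemma mul_single_mul_apply {n : Type*} [Fintype n] [DecidableEq n] (A B : Matrix n n ℝ)
    (a b k j : n) : (A * Matrix.single a b (1 : ℝ) * B : Matrix n n ℝ) k j = A k a * B b j := by
  rw [Matrix.mul_apply, Finset.sum_eq_single b]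
  · rw [Matrix.mul_single_apply_same, mul_one]
  · intro c _ hc
    rw [Matrix.mul_single_apply_of_ne _ _ _ _ _ hc, zero_mul]
  · simp

variable {θ : D.IncMatrix}

lemma inv_loopDiagonal (hθ : D.edgeCoord θ ∈ D.chol) :
    (D.loopDiagonal θ)⁻¹ = Matrix.diagonal fun i => ((D.edgeCoord θ).1 i)⁻¹ :=
  inv_diagonal_of_pos hθ

lemma dCholPrec_single_loop (hθ : D.edgeCoord θ ∈ D.chol) (b : Fin p) :
    D.dCholPrec θ (Pi.single (D.edgeTo b (Sum.inl ())) 1) =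
      -(D.lowerMatrix (D.edgeCoord θ).2 * Matrix.diagonal (fun i => ((D.edgeCoord θ).1 i)⁻¹) *
        Matrix.single b b 1 * (Matrix.diagonal (fun i => ((D.edgeCoord θ).1 i)⁻¹) *
        (D.lowerMatrix (D.edgeCoord θ).2)ᵀ)) := by
  rw [dCholPrec, strictLower_single_loop, loopDiagonal_single_loop, inv_loopDiagonal D hθ,
    ← lowerMatrix_edgeCoord]
  simp [Matrix.mul_assoc]

/-- The factors `1` give both terms the shape matrix, matrix unit, matrix, so that
`mul_single_mul_apply` factors their entries. -/
lemma dCholPrec_single_arrow (hθ : D.edgeCoord θ ∈ D.chol) (b : Fin p) (a : D.pa b) :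
    D.dCholPrec θ (Pi.single (D.edgeTo b (Sum.inr a)) 1) =
      1 * Matrix.single a.1 b 1 * (Matrix.diagonal (fun i => ((D.edgeCoord θ).1 i)⁻¹) *
        (D.lowerMatrix (D.edgeCoord θ).2)ᵀ) +
      D.lowerMatrix (D.edgeCoord θ).2 * Matrix.diagonal (fun i => ((D.edgeCoord θ).1 i)⁻¹) *
        Matrix.single b a.1 1 * 1 := by
  rw [dCholPrec, strictLower_single_arrow, loopDiagonal_single_arrow, inv_loopDiagonal D hθ,
    ← lowerMatrix_edgeCoord]
  simp [Matrix.mul_assoc, Matrix.transpose_single]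

/-- Varying a parameter of column `b` moves no edge entry in a column `i < b`, since `L i b = 0`;
hence the transposed Jacobian matrix is block triangular. In block `i` the loop contributes `-(d
i)⁻²` and each arrow `(d i)⁻¹`. -/
lemma abs_det_proj_cholPrec (hθ : D.edgeCoord θ ∈ D.chol) {J : D.IncMatrix →L[ℝ] D.IncMatrix}
    (hJ : ∀ h, J h = D.proj (D.dCholPrec θ h)) :
    |J.det| = ∏ i, ((D.edgeCoord θ).1 i ^ ((D.pa i).card + 2))⁻¹ := by
  set d := (D.edgeCoord θ).1 with hd
  set L := D.lowerMatrix (D.edgeCoord θ).2 with hL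
  have hdet : J.det = (LinearMap.toMatrix' (J : D.IncMatrix →ₗ[ℝ] D.IncMatrix))ᵀ.det := by
    rw [Matrix.det_transpose, LinearMap.det_toMatrix']
  have happ (e f) : (LinearMap.toMatrix' (J : D.IncMatrix →ₗ[ℝ] D.IncMatrix))ᵀ f e =
      D.dCholPrec θ (Pi.single f 1) e.1.1 e.1.2 := by
    rw [Matrix.transpose_apply, LinearMap.toMatrix'_apply]
    exact congrFun (hJ _) e
  have hloop (b k i : Fin p) : D.dCholPrec θ (Pi.single (D.edgeTo b (Sum.inl ())) 1) k i =
      -(L k b * (d b)⁻¹ * ((d b)⁻¹ * L i b)) := by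
    rw [D.dCholPrec_single_loop hθ, Matrix.neg_apply, mul_single_mul_apply, Matrix.mul_diagonal,
      Matrix.diagonal_mul, Matrix.transpose_apply]
  have harrow (b k i : Fin p) (a : D.pa b) :
      D.dCholPrec θ (Pi.single (D.edgeTo b (Sum.inr a)) 1) k i =
      (if k = a then 1 else 0) * ((d b)⁻¹ * L i b) +
        L k b * (d b)⁻¹ * (if a.1 = i then 1 else 0) := by
    rw [D.dCholPrec_single_arrow hθ, Matrix.add_apply, mul_single_mul_apply,
      mul_single_mul_apply, Matrix.mul_diagonal, Matrix.diagonal_mul, Matrix.transpose_apply,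
      Matrix.one_apply, Matrix.one_apply]
  rw [hdet, D.det_of_blockTriangular_edge, Finset.abs_prod]
  · refine Finset.prod_congr rfl fun i _ => ?_
    have hblock : (LinearMap.toMatrix' (J : D.IncMatrix →ₗ[ℝ] D.IncMatrix))ᵀ.submatrix
        (D.edgeTo i) (D.edgeTo i) = Matrix.fromBlocks (Matrix.of fun _ _ => -((d i)⁻¹ * (d i)⁻¹))
          (Matrix.of fun _ (k : D.pa i) => -(L k i * (d i)⁻¹ * (d i)⁻¹)) 0
          (Matrix.diagonal fun _ => (d i)⁻¹) := by
      ext (⟨⟩ | a) (⟨⟩ | k)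
      · rw [Matrix.submatrix_apply, happ, hloop]
        simp [edgeTo, hL, D.lowerMatrix_diag]
      · rw [Matrix.submatrix_apply, happ, hloop]
        simp [edgeTo, hL, D.lowerMatrix_diag]
      · have h1 : a.1 ≠ i := (D.lt_of_mem_pa a.2).ne'
        rw [Matrix.submatrix_apply, happ, harrow]
        simp [edgeTo, h1, h1.symm]
      · have h1 : a.1 ≠ i := (D.lt_of_mem_pa a.2).ne'
        rw [Matrix.submatrix_apply, happ, harrow]
        by_cases h2 : a = k
        · subst h2
          simp [edgeTo, hL, D.lowerMatrix_diag, h1]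
        · have h3 : k.1 ≠ a.1 := fun h => h2 (Subtype.ext h.symm)
          simp [edgeTo, h1, h2, h3]
    rw [hblock, Matrix.det_fromBlocks_zero₂₁, Matrix.det_diagonal, Matrix.det_unique]
    have hpos : 0 < d i := hθ i
    simp only [Matrix.of_apply, Finset.prod_const, Finset.card_univ, Fintype.card_coe]
    rw [abs_mul, abs_neg, abs_of_pos (by positivity), abs_of_pos (by positivity), pow_add,
      mul_inv, inv_pow, sq, mul_inv]
    ring
  · intro f e
    induction f using D.edge_cases with
    | loop b =>
      intro h
      have h' : e.1.2 < b := h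
      rw [happ, hloop, hL, D.lowerMatrix_of_lt _ h']
      ring
    | arrow b a =>
      intro h
      have h' : e.1.2 < b := h
      have h1 : a.1 ≠ e.1.2 := (h'.trans (D.lt_of_mem_pa a.2)).ne'
      rw [happ, harrow, hL, D.lowerMatrix_of_lt _ h', if_neg h1]
      ring

/-- In `-Σ dΩ Σ` the outer factors turn `L` into `M = Lᵀ Σ`, which is lower triangular. A parameter
of column `b` therefore moves no edge entry in a column `i > b`, the opposite direction to the
precision chart. The diagonal blocks have a `1` for the loop and `-Σ_pa(i)` for the arrows. -/
lemma abs_det_proj_cholPrec_inv (hθ : D.edgeCoord θ ∈ D.chol)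
    {J : D.IncMatrix →L[ℝ] D.IncMatrix}
    (hJ : ∀ h, J h = D.proj (-((D.cholPrec (D.edgeCoord θ))⁻¹ * D.dCholPrec θ h *
        (D.cholPrec (D.edgeCoord θ))⁻¹))) :
    |J.det| = ∏ i, (sub (D.cholPrec (D.edgeCoord θ))⁻¹ (D.pa i)).det := by
  set d := (D.edgeCoord θ).1 with hd
  set L := D.lowerMatrix (D.edgeCoord θ).2 with hL
  set S := (D.cholPrec (D.edgeCoord θ))⁻¹ with hS
  set M := Lᵀ * S with hM
  have hpd : S.PosDef := D.cholPrec_inv_posDef hθ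
  have hSsymm : Sᵀ = S := by simpa using hpd.isHermitian.eq
  have hsym (a b) : S a b = S b a := by simpa using hpd.isHermitian.apply b a
  have hMT : S * L = Mᵀ := by rw [hM, Matrix.transpose_mul, Matrix.transpose_transpose, hSsymm]
  have hMlt (i k) (h : i < k) : M i k = 0 := D.transpose_mul_inv_of_lt hθ h
  have hMd (i) : M i i = d i := D.transpose_mul_inv_diag hθ i
  have hdpos (i) : 0 < d i := hθ i
  have hdet : J.det = (LinearMap.toMatrix' (J : D.IncMatrix →ₗ[ℝ] D.IncMatrix)).det := by
    rw [LinearMap.det_toMatrix']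
  have happ (e f) : (LinearMap.toMatrix' (J : D.IncMatrix →ₗ[ℝ] D.IncMatrix)) e f =
      -(S * D.dCholPrec θ (Pi.single f 1) * S) e.1.1 e.1.2 := by
    rw [LinearMap.toMatrix'_apply]
    exact congrFun (hJ _) e
  have hloop (b k i : Fin p) :
      (S * D.dCholPrec θ (Pi.single (D.edgeTo b (Sum.inl ())) 1) * S) k i =
      -(M b k * (d b)⁻¹ * ((d b)⁻¹ * M b i)) := by
    rw [D.dCholPrec_single_loop hθ, Matrix.mul_neg, Matrix.neg_mul, Matrix.neg_apply]
    have : S * (L * Matrix.diagonal (fun i => (d i)⁻¹) * Matrix.single b b 1 *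
        (Matrix.diagonal (fun i => (d i)⁻¹) * Lᵀ)) * S =
        Mᵀ * Matrix.diagonal (fun i => (d i)⁻¹) * Matrix.single b b 1 *
          (Matrix.diagonal (fun i => (d i)⁻¹) * M) := by
      rw [← hMT, hM]
      simp only [Matrix.mul_assoc]
    rw [this, mul_single_mul_apply, Matrix.mul_diagonal, Matrix.diagonal_mul,
      Matrix.transpose_apply]
  have harrow (b k i : Fin p) (a : D.pa b) :
      (S * D.dCholPrec θ (Pi.single (D.edgeTo b (Sum.inr a)) 1) * S) k i =
      S k a * ((d b)⁻¹ * M b i) + M b k * (d b)⁻¹ * S a i := by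
    rw [D.dCholPrec_single_arrow hθ]
    have : S * (1 * Matrix.single a.1 b 1 * (Matrix.diagonal (fun i => (d i)⁻¹) * Lᵀ) +
        L * Matrix.diagonal (fun i => (d i)⁻¹) * Matrix.single b a.1 1 * 1) * S =
        S * Matrix.single a.1 b 1 * (Matrix.diagonal (fun i => (d i)⁻¹) * M) +
        Mᵀ * Matrix.diagonal (fun i => (d i)⁻¹) * Matrix.single b a.1 1 * S := by
      rw [← hMT, hM]
      simp only [Matrix.mul_assoc, Matrix.one_mul, Matrix.mul_add, Matrix.add_mul]
    rw [this, Matrix.add_apply, mul_single_mul_apply, mul_single_mul_apply, Matrix.mul_diagonal,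
      Matrix.diagonal_mul, Matrix.transpose_apply]
  rw [hdet, D.det_of_blockTriangular_edge, Finset.abs_prod]
  · refine Finset.prod_congr rfl fun i _ => ?_
    have hblock : (LinearMap.toMatrix' (J : D.IncMatrix →ₗ[ℝ] D.IncMatrix)).submatrix
        (D.edgeTo i) (D.edgeTo i) = Matrix.fromBlocks (Matrix.of fun _ _ => 1)
          (Matrix.of fun _ (a : D.pa i) => -(S i a + S a i)) 0 (-sub S (D.pa i)) := by
      have hne := (hdpos i).ne'
      ext (⟨⟩ | k) (⟨⟩ | a)
      · rw [Matrix.submatrix_apply, happ, hloop]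
        simp [edgeTo, hMd, hne]
      · rw [Matrix.submatrix_apply, happ, harrow]
        simp [edgeTo, hMd, hne]
      · rw [Matrix.submatrix_apply, happ, hloop]
        simp [edgeTo, hMlt i k (D.lt_of_mem_pa k.2)]
      · rw [Matrix.submatrix_apply, happ, harrow]
        simp [edgeTo, hMlt i k (D.lt_of_mem_pa k.2), hMd, hne, sub]
    rw [hblock, Matrix.det_fromBlocks_zero₂₁, Matrix.det_unique, Matrix.of_apply, one_mul,
      Matrix.det_neg, abs_mul, abs_pow, abs_neg, abs_one, one_pow, one_mul,
      abs_of_pos (sub_posDef hpd _).det_pos]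
  · intro e f
    induction f using D.edge_cases with
    | loop b =>
      intro h
      have h' : b < e.1.2 := h
      rw [happ, hloop, hMlt _ _ h']
      ring
    | arrow b a =>
      intro h
      have h' : b < e.1.2 := h
      have h2 : b < e.1.1 := by
        rcases e.2 with h3 | h3
        · rw [h3]; exact h'
        · exact h'.trans (D.lt_of_adj _ _ h3)
      rw [happ, harrow, hMlt _ _ h', hMlt _ _ h2]
      ring

end ParentOrderedDAG

/-! ### Gaussian and inverse gamma integrals -/

namespace MeasureTheory

lemma lintegral_pi_ofReal_prod {ι : Type*} [Fintype ι] {E : ι → Type*}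
    [∀ i, MeasurableSpace (E i)] (μ : ∀ i, Measure (E i)) [∀ i, SigmaFinite (μ i)]
    {f : ∀ i, E i → ℝ} (hf : ∀ i, Integrable (f i) (μ i)) (h0 : ∀ i, 0 ≤ᵐ[μ i] f i) :
    ∫⁻ x, ENNReal.ofReal (∏ i, f i (x i)) ∂Measure.pi μ =
      ENNReal.ofReal (∏ i, ∫ x, f i x ∂μ i) := by
  rw [← integral_fintype_prod_eq_prod, ofReal_integral_eq_lintegral_ofReal]
  · exact Integrable.fintype_prod_dep hf
  · have h : ∀ᵐ x ∂Measure.pi μ, ∀ i, 0 ≤ f i (x i) := by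
      rw [ae_all_iff]
      exact fun i => (Measure.quasiMeasurePreserving_eval μ i).ae (h0 i)
    filter_upwards [h] with x hx using Finset.prod_nonneg fun i _ => hx i

end MeasureTheory

open scoped MatrixOrder Matrix.Norms.L2Operator in
lemma Matrix.PosSemidef.exists_eq_transpose_mul_self {ι : Type*} [Fintype ι] [DecidableEq ι]
    {Q : Matrix ι ι ℝ} (hQ : Q.PosSemidef) : ∃ B : Matrix ι ι ℝ, Q = Bᵀ * B := by
  obtain ⟨B, hB⟩ := CStarAlgebra.nonneg_iff_eq_star_mul_self.mp hQ.nonneg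
  exact ⟨B, by simpa [Matrix.star_eq_conjTranspose] using hB⟩

/-- The Gaussian integral on `ℝ^ι`. -/
lemma lintegral_exp_neg_half_quadratic {ι : Type*} [Fintype ι] [DecidableEq ι]
    {Q : Matrix ι ι ℝ} (hQ : Q.PosSemidef) (hdet : 0 < Q.det) (m : ι → ℝ) :
    ∫⁻ x : ι → ℝ, ENNReal.ofReal (Real.exp (-(1 / 2) * ((x - m) ⬝ᵥ Q *ᵥ (x - m)))) =
      ENNReal.ofReal (√(2 * Real.pi) ^ Fintype.card ι * (√Q.det)⁻¹) := by
  -- After translating by `m`, the substitution `y = B x` reduces to a product of one-dimensional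
  -- Gaussians; its Jacobian is `|det B| = √(det Q)`.
  obtain ⟨B, rfl⟩ := hQ.exists_eq_transpose_mul_self
  rw [Matrix.det_mul, Matrix.det_transpose] at hdet ⊢
  have hB : B.det ≠ 0 := fun h => by simp [h] at hdet
  have hq (x : ι → ℝ) : x ⬝ᵥ (Bᵀ * B) *ᵥ x = ∑ i, (Matrix.toLin' B x i) ^ 2 := by
    rw [← Matrix.mulVec_mulVec, Matrix.dotProduct_mulVec, Matrix.vecMul_transpose,
      Matrix.toLin'_apply]
    exact Finset.sum_congr rfl fun i _ => (sq _).symm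
  have hg : Measurable fun y : ι → ℝ => ENNReal.ofReal (Real.exp (-(1 / 2) * ∑ i, y i ^ 2)) := by
    fun_prop
  rw [lintegral_sub_right_eq_self
    (fun x : ι → ℝ => ENNReal.ofReal (Real.exp (-(1 / 2) * (x ⬝ᵥ (Bᵀ * B) *ᵥ x)))) m]
  simp only [hq]
  have hm : Measurable (Matrix.toLin' B) := (Matrix.toLin' B).continuous_of_finiteDimensional.measurable
  rw [← lintegral_map hg hm, Real.map_matrix_volume_pi_eq_smul_volume_pi hB, lintegral_smul_measure]
  have hprod (y : ι → ℝ) : Real.exp (-(1 / 2) * ∑ i, y i ^ 2) =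
      ∏ i, Real.exp (-(1 / 2) * y i ^ 2) := by
    rw [← Real.exp_sum, Finset.mul_sum]
  simp only [hprod]
  have h1 := lintegral_pi_ofReal_prod (ι := ι) (fun _ => (volume : Measure ℝ))
    (f := fun _ x => Real.exp (-(1 / 2) * x ^ 2))
    (fun _ => integrable_exp_neg_mul_sq (by norm_num))
    (fun _ => Filter.Eventually.of_forall fun _ => (Real.exp_pos _).le)
  rw [← volume_pi] at h1
  rw [h1, smul_eq_mul, ← ENNReal.ofReal_mul (abs_nonneg _), ← sq, Real.sqrt_sq_eq_abs, abs_inv]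
  congr 1
  rw [Finset.prod_const, integral_gaussian, Finset.card_univ, mul_comm]
  congr 4
  field_simp

lemma integral_rpow_mul_exp_neg_div_Ioi {s b : ℝ} (hs : 0 < s) (hb : 0 < b) :
    ∫ x in Ioi (0 : ℝ), x ^ (-(s + 1)) * Real.exp (-(b / x)) = b ^ (-s) * Real.Gamma s := by
  -- The substitution `y = x⁻¹` turns this into a gamma integral.
  have h := integral_comp_rpow_Ioi (fun y : ℝ => y ^ (s - 1) * Real.exp (-(b * y)))
    (p := -1) (by norm_num)
  rw [Real.integral_rpow_mul_exp_neg_mul_Ioi hs hb] at h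
  rw [one_div, Real.inv_rpow hb.le, ← Real.rpow_neg hb.le] at h
  rw [← h]
  refine setIntegral_congr_fun measurableSet_Ioi fun x hx => ?_
  have hx : (0 : ℝ) < x := hx
  simp only [smul_eq_mul, abs_neg, abs_one, one_mul]
  rw [← mul_assoc, ← Real.rpow_mul hx.le, ← Real.rpow_add hx, Real.rpow_neg_one, div_eq_mul_inv]
  congr 2
  ring

lemma integrableOn_rpow_mul_exp_neg_div_Ioi {s b : ℝ} (hs : 0 < s) (hb : 0 < b) :
    IntegrableOn (fun x : ℝ => x ^ (-(s + 1)) * Real.exp (-(b / x))) (Ioi 0) := by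
  -- The Bochner integral of a non-integrable function is `0`, so the positive value just computed
  -- proves integrability.
  refine Integrable.of_integral_ne_zero ?_
  rw [integral_rpow_mul_exp_neg_div_Ioi hs hb]
  have := Real.Gamma_pos_of_pos hs
  positivity

/-! ### The normalizing constant of the DAG-Wishart distributions -/

namespace ParentOrderedDAG

open scoped Classical

variable {p : ℕ} (D : ParentOrderedDAG p)

/-- The arrows that point to `i`. -/
def arrowTo (i : Fin p) (j : D.pa i) : D.Arrow := ⟨(j, i), D.mem_pa.1 j.2⟩

/-- The arrows, sorted by their target. -/
noncomputable def arrowEquiv : (Σ i, D.pa i) ≃ D.Arrow where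
  toFun s := D.arrowTo s.1 s.2
  invFun a := ⟨a.1.2, a.1.1, D.mem_pa.2 a.2⟩
  left_inv _ := rfl
  right_inv _ := rfl

lemma sum_arrow {M : Type*} [AddCommMonoid M] (f : D.Arrow → M) :
    ∑ a, f a = ∑ i, ∑ j : D.pa i, f (D.arrowTo i j) := by
  rw [← D.arrowEquiv.sum_comp, Fintype.sum_sigma]
  rfl

lemma card_arrow : Fintype.card D.Arrow = ∑ i, (D.pa i).card := by
  rw [← Fintype.card_congr D.arrowEquiv, Fintype.card_sigma]
  simp

/-- The parents of `i` correspond to the arrows that point to `i`. -/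
def paEquivArrow (i : Fin p) : D.pa i ≃ {a : D.Arrow // a.1.2 = i} where
  toFun j := ⟨D.arrowTo i j, rfl⟩
  invFun a := ⟨a.1.1.1, by obtain ⟨⟨⟨a, b⟩, h⟩, rfl⟩ := a; exact D.mem_pa.2 h⟩
  left_inv _ := rfl
  right_inv := by rintro ⟨⟨⟨a, b⟩, h⟩, rfl⟩; rfl

/-- The block diagonal quadratic form on the arrows with blocks `U_pa(i) / d i`. -/
noncomputable def arrowForm (U : Matrix (Fin p) (Fin p) ℝ) (d : Fin p → ℝ) :
    Matrix D.Arrow D.Arrow ℝ :=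
  Matrix.of fun e f => if e.1.2 = f.1.2 then (d e.1.2)⁻¹ * U e.1.1 f.1.1 else 0

variable {U : Matrix (Fin p) (Fin p) ℝ} {d : Fin p → ℝ}

lemma dotProduct_arrowForm (x : D.Arrow → ℝ) :
    x ⬝ᵥ D.arrowForm U d *ᵥ x =
      ∑ i, (d i)⁻¹ * ∑ j : D.pa i, ∑ k : D.pa i, x (D.arrowTo i j) * (U j k * x (D.arrowTo i k)) := by
  simp only [dotProduct, Matrix.mulVec]
  rw [D.sum_arrow]
  refine Finset.sum_congr rfl fun i _ => ?_
  rw [Finset.mul_sum]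
  refine Finset.sum_congr rfl fun j _ => ?_
  rw [D.sum_arrow, Finset.sum_eq_single i, Finset.mul_sum, Finset.mul_sum]
  · refine Finset.sum_congr rfl fun k _ => ?_
    simp only [arrowForm, arrowTo, Matrix.of_apply, if_true]
    ring
  · intro b _ hb
    refine Finset.sum_eq_zero fun k _ => ?_
    simp [arrowForm, arrowTo, hb.symm]
  · simp

/-- The matrix is block diagonal for the grouping of arrows by target, and block `i` is `(d i)⁻¹ •
U_pa(i)`. -/
lemma det_arrowForm :
    (D.arrowForm U d).det = ∏ i, ((d i)⁻¹ ^ (D.pa i).card * (sub U (D.pa i)).det) := by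
  have hb : (D.arrowForm U d).BlockTriangular fun a => a.1.2 := by
    intro e f h
    simp [arrowForm, h.ne']
  rw [hb.det_fintype]
  refine Finset.prod_congr rfl fun i _ => ?_
  rw [← Matrix.det_submatrix_equiv_self (D.paEquivArrow i)]
  have : ((D.arrowForm U d).toSquareBlock (fun a => a.1.2) i).submatrix
      (D.paEquivArrow i) (D.paEquivArrow i) = (d i)⁻¹ • sub U (D.pa i) := by
    ext j k
    simp [arrowForm, paEquivArrow, arrowTo, sub, Matrix.toSquareBlock_def]
  rw [this, Matrix.det_smul, Fintype.card_coe]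

lemma posSemidef_arrowForm (hU : U.PosDef) (hd : ∀ i, 0 < d i) :
    (D.arrowForm U d).PosSemidef := by
  have hsym (a b) : U a b = U b a := by simpa using hU.isHermitian.apply b a
  refine .of_dotProduct_mulVec_nonneg ?_ fun x => ?_
  · ext e f
    simp only [Matrix.conjTranspose_apply, arrowForm, Matrix.of_apply, star_trivial]
    by_cases h : e.1.2 = f.1.2
    · rw [if_pos h, if_pos h.symm, h, hsym]
    · rw [if_neg h, if_neg (Ne.symm h)]
  · rw [star_trivial, D.dotProduct_arrowForm]
    refine Finset.sum_nonneg fun i _ => mul_nonneg (inv_pos.2 (hd i)).le ?_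
    have h := (sub_posDef hU (D.pa i)).posSemidef.dotProduct_mulVec_nonneg
      fun j => x (D.arrowTo i j)
    simpa [dotProduct, Matrix.mulVec, Finset.mul_sum, sub] using h

/-- Completing the square in every column of `L`. -/
lemma trace_cholPrec_mul (hU : U.PosDef) {m : D.Arrow → ℝ}
    (hm : ∀ i, ∀ k ∈ D.pa i, ((D.lowerMatrix m)ᵀ * U) i k = 0) {t : D.CholCoord}
    (ht : t ∈ D.chol) :
    (D.cholPrec t * U).trace = (t.2 - m) ⬝ᵥ D.arrowForm U t.1 *ᵥ (t.2 - m) +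
      ∑ i, (t.1 i)⁻¹ * ((sub U (D.fa i)).det / (sub U (D.pa i)).det) := by
  have hsym (a b) : U a b = U b a := by simpa using hU.isHermitian.apply b a
  -- The normal equations for the regression with matrix `U`; they remove the linear terms when the
  -- square is completed around `m`.
  have hm' (i : Fin p) (k : D.pa i) : ∑ j : D.pa i, U k j * m (D.arrowTo i j) = -U k i := by
    have h := hm i k k.2
    rw [D.transpose_lowerMatrix_mul_apply] at h
    have e : ∑ j : D.pa i, U k j * m (D.arrowTo i j) =
        ∑ j : D.pa i, m ⟨(j, i), D.mem_pa.1 j.2⟩ * U j k :=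
      Finset.sum_congr rfl fun j _ => by rw [hsym k, mul_comm]; rfl
    rw [e, hsym k i]
    linarith
  have hc (i : Fin p) : (sub U (D.fa i)).det / (sub U (D.pa i)).det =
      U i i + ∑ j : D.pa i, U i j * m (D.arrowTo i j) := by
    have h0 := (sub_posDef hU (D.pa i)).det_pos.ne'
    rw [D.det_sub_fa U i h0.isUnit _ (hm' i), mul_div_cancel_left₀ _ h0]
  -- By cyclicity the trace is a sum over columns of `L` of the form `U`, weighted by `(D i)⁻¹`.
  have htr : (D.cholPrec t * U).trace =
      ∑ i, (t.1 i)⁻¹ * ((D.lowerMatrix t.2)ᵀ * U * D.lowerMatrix t.2) i i := by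
    rw [D.cholPrec_eq ht, Matrix.mul_assoc, Matrix.mul_assoc, Matrix.trace_mul_comm,
      Matrix.mul_assoc, Matrix.trace]
    simp only [Matrix.diag_apply, Matrix.diagonal_mul]
  rw [htr, D.dotProduct_arrowForm, ← Finset.sum_add_distrib]
  refine Finset.sum_congr rfl fun i _ => ?_
  rw [← mul_add]
  congr 1
  set l : D.pa i → ℝ := fun j => t.2 (D.arrowTo i j) with hl
  set n : D.pa i → ℝ := fun j => m (D.arrowTo i j) with hn
  have hq : ((D.lowerMatrix t.2)ᵀ * U * D.lowerMatrix t.2) i i =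
      U i i + ∑ j : D.pa i, l j * U j i + ∑ j : D.pa i, l j * (U i j + ∑ k : D.pa i, l k * U k j) := by
    rw [Matrix.mul_apply]
    have e : ∑ j, ((D.lowerMatrix t.2)ᵀ * U) i j * D.lowerMatrix t.2 j i =
        ∑ j, D.lowerMatrix t.2 j i * ((D.lowerMatrix t.2)ᵀ * U) i j :=
      Finset.sum_congr rfl fun j _ => mul_comm _ _
    rw [e, D.sum_lowerMatrix_mul, D.transpose_lowerMatrix_mul_apply]
    simp only [D.transpose_lowerMatrix_mul_apply]
    rfl
  have hln : ∑ j : D.pa i, ∑ k : D.pa i, l j * (U j k * n k) = -∑ j : D.pa i, l j * U j i := by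
    rw [← Finset.sum_neg_distrib]
    refine Finset.sum_congr rfl fun j _ => ?_
    rw [← Finset.mul_sum, hm' i j, mul_neg]
  have hnl : ∑ j : D.pa i, ∑ k : D.pa i, n j * (U j k * l k) = -∑ j : D.pa i, l j * U j i := by
    rw [Finset.sum_comm, ← hln]
    refine Finset.sum_congr rfl fun j _ => Finset.sum_congr rfl fun k _ => ?_
    rw [hsym]
    ring
  have hnn : ∑ j : D.pa i, ∑ k : D.pa i, n j * (U j k * n k) = -∑ j : D.pa i, U i j * n j := by
    rw [← Finset.sum_neg_distrib]
    refine Finset.sum_congr rfl fun j _ => ?_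
    rw [← Finset.mul_sum, hm' i j, hsym i j]
    ring
  have hll : ∑ j : D.pa i, l j * (U i j + ∑ k : D.pa i, l k * U k j) =
      ∑ j : D.pa i, l j * U j i + ∑ j : D.pa i, ∑ k : D.pa i, l j * (U j k * l k) := by
    rw [← Finset.sum_add_distrib]
    refine Finset.sum_congr rfl fun j _ => ?_
    rw [mul_add, Finset.mul_sum, hsym i j]
    congr 1
    refine Finset.sum_congr rfl fun k _ => ?_
    rw [hsym k j]
    ring
  have hexp : ∑ j : D.pa i, ∑ k : D.pa i, (t.2 - m) (D.arrowTo i j) *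
        (U j k * (t.2 - m) (D.arrowTo i k)) =
      ∑ j : D.pa i, ∑ k : D.pa i, l j * (U j k * l k)
        - ∑ j : D.pa i, ∑ k : D.pa i, l j * (U j k * n k)
        - ∑ j : D.pa i, ∑ k : D.pa i, n j * (U j k * l k)
        + ∑ j : D.pa i, ∑ k : D.pa i, n j * (U j k * n k) := by
    simp only [← Finset.sum_sub_distrib, ← Finset.sum_add_distrib]
    refine Finset.sum_congr rfl fun j _ => Finset.sum_congr rfl fun k _ => ?_
    simp only [Pi.sub_apply, hl, hn]
    ring
  rw [hexp, hq, hc, hll, hln, hnl, hnn]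
  ring

lemma chol_eq_prod : D.chol = (univ.pi fun _ => Ioi (0 : ℝ)) ×ˢ (univ : Set (D.Arrow → ℝ)) := by
  ext t; simp [chol]

lemma measurableSet_chol : MeasurableSet D.chol := by
  rw [chol_eq_prod]
  exact (MeasurableSet.univ_pi fun _ => measurableSet_Ioi).prod MeasurableSet.univ

/-- The integral of the DAG-Wishart kernel over the regression coefficients. -/
lemma lintegral_arrow_gaussian (hU : U.PosDef) (hd : ∀ i, 0 < d i) (m : D.Arrow → ℝ) :
    ∫⁻ l : D.Arrow → ℝ, ENNReal.ofReal
        (Real.exp (-(1 / 2) * ((l - m) ⬝ᵥ D.arrowForm U d *ᵥ (l - m)))) =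
      ENNReal.ofReal (∏ i, (√(2 * Real.pi) ^ (D.pa i).card *
        (√((d i)⁻¹ ^ (D.pa i).card * (sub U (D.pa i)).det))⁻¹)) := by
  have hpos (i : Fin p) : 0 < (d i)⁻¹ ^ (D.pa i).card * (sub U (D.pa i)).det :=
    mul_pos (pow_pos (inv_pos.2 (hd i)) _) (sub_posDef hU _).det_pos
  have hdet : 0 < (D.arrowForm U d).det := by
    rw [det_arrowForm]
    exact Finset.prod_pos fun i _ => hpos i
  rw [lintegral_exp_neg_half_quadratic (D.posSemidef_arrowForm hU hd) hdet, det_arrowForm,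
    card_arrow, ← Finset.prod_pow_eq_pow_sum, Real.sqrt_prod _ fun i _ => (hpos i).le,
    ← Finset.prod_inv_distrib, ← Finset.prod_mul_distrib]

/-- One factor of the normalizing constant. -/
lemma integral_inverseGamma_kernel {a n u f : ℝ} {k : ℕ} (hn : n = k) (ha : n + 2 < a)
    (hu : 0 < u) (hf : 0 < f) :
    IntegrableOn (fun x : ℝ => √(2 * Real.pi) ^ k * (√(x⁻¹ ^ k * u))⁻¹ *
      Real.exp (-(1 / 2) * (x⁻¹ * (f / u))) * x ^ (-(1 / 2) * a)) (Ioi 0) ∧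
    ∫ x in Ioi (0 : ℝ), √(2 * Real.pi) ^ k * (√(x⁻¹ ^ k * u))⁻¹ *
      Real.exp (-(1 / 2) * (x⁻¹ * (f / u))) * x ^ (-(1 / 2) * a) =
    Real.Gamma (a / 2 - n / 2 - 1) * 2 ^ (a / 2 - 1) * √Real.pi ^ k *
      u ^ (a / 2 - n / 2 - 3 / 2) / f ^ (a / 2 - n / 2 - 1) := by
  -- The shape of the inverse gamma integral: the Gaussian integral contributes `x ^ (n / 2)`, and
  -- `n / 2 - a / 2 = -(s + 1)`. The hypothesis `n + 2 < a` is exactly `0 < s`.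
  set s := a / 2 - n / 2 - 1 with hs
  have hs0 : 0 < s := by rw [hs]; linarith
  have hb : 0 < f / u / 2 := by positivity
  have heq : EqOn (fun x : ℝ => √(2 * Real.pi) ^ k * (√(x⁻¹ ^ k * u))⁻¹ *
      Real.exp (-(1 / 2) * (x⁻¹ * (f / u))) * x ^ (-(1 / 2) * a))
      (fun x => (√(2 * Real.pi) ^ k * (√u)⁻¹) *
        (x ^ (-(s + 1)) * Real.exp (-(f / u / 2 / x)))) (Ioi 0) := by
    intro x hx
    have hx : 0 < x := hx
    have h1 : (√(x⁻¹ ^ k * u))⁻¹ = x ^ (n / 2) * (√u)⁻¹ := by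
      rw [Real.sqrt_mul (by positivity), mul_inv, Real.sqrt_eq_rpow, inv_pow,
        Real.inv_rpow (by positivity), inv_inv, ← Real.rpow_natCast, ← Real.rpow_mul hx.le, hn]
      congr 2
      ring
    have h2 : -(1 / 2) * (x⁻¹ * (f / u)) = -(f / u / 2 / x) := by ring
    have h3 : x ^ (-(s + 1)) = x ^ (n / 2) * x ^ (-(1 / 2) * a) := by
      rw [← Real.rpow_add hx]
      congr 1
      rw [hs]; ring
    simp only [h1, h2, h3]
    ring
  have hint := (integrableOn_rpow_mul_exp_neg_div_Ioi hs0 hb).const_mul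
    (√(2 * Real.pi) ^ k * (√u)⁻¹)
  refine ⟨IntegrableOn.congr_fun hint heq.symm measurableSet_Ioi, ?_⟩
  rw [setIntegral_congr_fun measurableSet_Ioi heq, integral_const_mul,
    integral_rpow_mul_exp_neg_div_Ioi hs0 hb]
  have h2 : (f / u / 2) ^ (-s) = 2 ^ s * u ^ s / f ^ s := by
    rw [Real.rpow_neg hb.le, Real.div_rpow (by positivity) (by norm_num),
      Real.div_rpow hf.le hu.le]
    field_simp
  have h3 : (2 : ℝ) ^ (a / 2 - 1) = √2 ^ k * 2 ^ s := by
    rw [Real.sqrt_eq_rpow, ← Real.rpow_natCast, ← Real.rpow_mul (by norm_num),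
      ← Real.rpow_add (by norm_num), ← hn]
    congr 1
    rw [hs]; ring
  have h4 : u ^ (a / 2 - n / 2 - 3 / 2) = (√u)⁻¹ * u ^ s := by
    rw [Real.sqrt_eq_rpow, ← Real.rpow_neg hu.le, ← Real.rpow_add hu]
    congr 1
    rw [hs]; ring
  rw [h2, h3, h4, Real.sqrt_mul (by norm_num), mul_pow]
  ring

lemma normConst_pos (hU : U.PosDef) {α : Fin p → ℝ} (hα : ∀ i, ((D.pa i).card : ℝ) + 2 < α i) :
    0 < D.normConst U α := by
  refine Finset.prod_pos fun i _ => ?_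
  have h1 : 0 < Real.Gamma (α i / 2 - ((D.pa i).card : ℝ) / 2 - 1) :=
    Real.Gamma_pos_of_pos (by linarith [hα i])
  have h2 := (sub_posDef hU (D.pa i)).det_pos
  have h3 := (sub_posDef hU (D.fa i)).det_pos
  have h4 := Real.pi_pos
  positivity

lemma continuousOn_cholPrec : ContinuousOn D.cholPrec D.chol := by
  have h : ContinuousOn (fun t : D.CholCoord => D.lowerMatrix t.2 *
      Matrix.diagonal (fun i => (t.1 i)⁻¹) * (D.lowerMatrix t.2)ᵀ) D.chol := by
    have hL : Continuous fun t : D.CholCoord => D.lowerMatrix t.2 := by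
      refine continuous_matrix fun i j => ?_
      by_cases hij : i = j
      · subst hij; simp only [D.lowerMatrix_diag]; fun_prop
      by_cases h : D.Adj i j
      · simp only [D.lowerMatrix_adj _ h]; fun_prop
      · simp only [D.lowerMatrix_of_not_adj _ hij h]; fun_prop
    have hd : ContinuousOn (fun t : D.CholCoord => Matrix.diagonal fun i => (t.1 i)⁻¹) D.chol := by
      refine continuousOn_of_forall_continuousAt fun t ht => ?_
      have : ContinuousAt (fun t : D.CholCoord => fun i => (t.1 i)⁻¹) t :=
        continuousAt_pi.2 fun i => ContinuousAt.inv₀ (by fun_prop) (ht i).ne'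
      exact (Continuous.matrix_diagonal continuous_id).continuousAt.comp this
    exact (hL.continuousOn.mul hd).mul hL.matrix_transpose.continuousOn
  exact h.congr fun t ht => D.cholPrec_eq ht

lemma aemeasurable_wishartChol_density (U : Matrix (Fin p) (Fin p) ℝ) (α : Fin p → ℝ) :
    AEMeasurable (fun t : D.CholCoord =>
      ENNReal.ofReal ((D.normConst U α)⁻¹ * Real.exp (-(1 / 2) * (D.cholPrec t * U).trace)
        * ∏ i, t.1 i ^ (-(1 / 2) * α i))) (volume.restrict D.chol) := by
  have htr : ContinuousOn (fun t => (D.cholPrec t * U).trace) D.chol :=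
    (Continuous.matrix_trace continuous_id).comp_continuousOn
      (D.continuousOn_cholPrec.mul continuousOn_const)
  have h1 : AEMeasurable (fun t => (D.cholPrec t * U).trace) (volume.restrict D.chol) :=
    htr.aemeasurable D.measurableSet_chol
  refine AEMeasurable.ennreal_ofReal (((h1.const_mul _).exp.const_mul _).mul ?_)
  fun_prop

/-- The DAG-Wishart distribution is a probability measure. -/
lemma wishartChol_univ (hU : U.PosDef) {α : Fin p → ℝ}
    (hα : ∀ i, ((D.pa i).card : ℝ) + 2 < α i) : D.wishartChol U α univ = 1 := by
  obtain ⟨m, hm⟩ := D.exists_regression hU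
  have hz := D.normConst_pos hU hα
  rw [wishartChol, withDensity_apply _ MeasurableSet.univ, Measure.restrict_univ]
  have hrestr : (volume.restrict D.chol : Measure D.CholCoord) =
      ((volume : Measure (Fin p → ℝ)).restrict (univ.pi fun _ => Ioi 0)).prod volume := by
    rw [D.chol_eq_prod, Measure.volume_eq_prod, ← Measure.prod_restrict, Measure.restrict_univ]
  have haem := D.aemeasurable_wishartChol_density U α
  rw [hrestr] at haem
  rw [hrestr, lintegral_prod _ haem]
  set g : Fin p → ℝ → ℝ := fun i x => √(2 * Real.pi) ^ (D.pa i).card *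
    (√(x⁻¹ ^ (D.pa i).card * (sub U (D.pa i)).det))⁻¹ *
    Real.exp (-(1 / 2) * (x⁻¹ * ((sub U (D.fa i)).det / (sub U (D.pa i)).det))) *
    x ^ (-(1 / 2) * α i) with hg
  have hG (i : Fin p) := integral_inverseGamma_kernel (k := (D.pa i).card) rfl (hα i)
    (sub_posDef hU (D.pa i)).det_pos (sub_posDef hU (D.fa i)).det_pos
  -- For fixed `d` the inner integral is Gaussian, centred at the regression `m` of `U`; what
  -- remains is a product of functions of the single `d i`.
  have hinner : ∀ d ∈ univ.pi (fun _ : Fin p => Ioi (0 : ℝ)),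
      ∫⁻ l : D.Arrow → ℝ, ENNReal.ofReal ((D.normConst U α)⁻¹ *
        Real.exp (-(1 / 2) * (D.cholPrec (d, l) * U).trace) * ∏ i, d i ^ (-(1 / 2) * α i)) =
      ENNReal.ofReal (D.normConst U α)⁻¹ * ENNReal.ofReal (∏ i, g i (d i)) := by
    intro d hd
    have hd : ∀ i, 0 < d i := fun i => hd i (mem_univ i)
    have hsplit (l : D.Arrow → ℝ) : ENNReal.ofReal ((D.normConst U α)⁻¹ *
        Real.exp (-(1 / 2) * (D.cholPrec (d, l) * U).trace) * ∏ i, d i ^ (-(1 / 2) * α i)) =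
        ENNReal.ofReal ((D.normConst U α)⁻¹ * ∏ i, (Real.exp (-(1 / 2) *
          ((d i)⁻¹ * ((sub U (D.fa i)).det / (sub U (D.pa i)).det))) * d i ^ (-(1 / 2) * α i))) *
        ENNReal.ofReal (Real.exp (-(1 / 2) * ((l - m) ⬝ᵥ D.arrowForm U d *ᵥ (l - m)))) := by
      rw [← ENNReal.ofReal_mul' (Real.exp_pos _).le,
        D.trace_cholPrec_mul hU hm (t := (d, l)) hd, mul_add, Real.exp_add, Finset.mul_sum,
        Real.exp_sum, Finset.prod_mul_distrib]
      congr 1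
      ring
    simp only [hsplit]
    rw [lintegral_const_mul' _ _ ENNReal.ofReal_ne_top, D.lintegral_arrow_gaussian hU hd,
      ENNReal.ofReal_mul (by positivity), mul_assoc, ← ENNReal.ofReal_mul]
    · congr 2
      rw [← Finset.prod_mul_distrib]
      refine Finset.prod_congr rfl fun i _ => ?_
      rw [hg]
      ring
    · exact Finset.prod_nonneg fun i _ => mul_nonneg (Real.exp_pos _).le
        (Real.rpow_nonneg (hd i).le _)
  rw [setLIntegral_congr_fun (MeasurableSet.univ_pi fun _ => measurableSet_Ioi) hinner,
    lintegral_const_mul' _ _ ENNReal.ofReal_ne_top, volume_pi, Measure.restrict_pi_pi,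
    lintegral_pi_ofReal_prod (f := g) _ (fun i => (hG i).1), ← ENNReal.ofReal_mul (by positivity)]
  · have : ∏ i, ∫ x in Ioi (0 : ℝ), g i x = D.normConst U α :=
      Finset.prod_congr rfl fun i _ => (hG i).2
    rw [this, inv_mul_cancel₀ hz.ne', ENNReal.ofReal_one]
  · intro i
    refine (ae_restrict_iff' measurableSet_Ioi).2 (Filter.Eventually.of_forall fun x hx => ?_)
    have hx : (0 : ℝ) < x := hx
    simp only [hg, Pi.zero_apply]
    positivity

end ParentOrderedDAG

/-! ### Charts of the spaces of incomplete matrices -/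

namespace ParentOrderedDAG

open scoped Classical Topology

variable {p : ℕ} (D : ParentOrderedDAG p)

/-- The edges are the loops and the arrows. -/
noncomputable def loopSumArrow : Fin p ⊕ D.Arrow ≃ D.Edge :=
  Equiv.ofBijective (Sum.elim (fun i => ⟨(i, i), Or.inl rfl⟩) fun a => ⟨a.1, Or.inr a.2⟩) <| by
    constructor
    · rintro (i | ⟨⟨a, b⟩, h⟩) (j | ⟨⟨a', b'⟩, h'⟩) hij <;>
        simp only [Sum.elim_inl, Sum.elim_inr, Subtype.mk.injEq, Prod.mk.injEq] at hij
      · rw [hij.1]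
      · obtain ⟨rfl, rfl⟩ := hij
        exact absurd (D.lt_of_adj _ _ h') (lt_irrefl _)
      · obtain ⟨rfl, rfl⟩ := hij
        exact absurd (D.lt_of_adj _ _ h) (lt_irrefl _)
      · obtain ⟨rfl, rfl⟩ := hij
        rfl
    · rintro ⟨⟨a, b⟩, h⟩
      by_cases hab : a = b
      · subst hab
        exact ⟨Sum.inl a, rfl⟩
      · exact ⟨Sum.inr ⟨(a, b), h.resolve_left hab⟩, rfl⟩

/-- `edgeCoord` as a measurable equivalence. -/
noncomputable def edgeCoordEquiv : D.IncMatrix ≃ᵐ D.CholCoord :=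
  (MeasurableEquiv.piCongrLeft (fun _ => ℝ) D.loopSumArrow).symm.trans
    (MeasurableEquiv.sumPiEquivProdPi fun _ : Fin p ⊕ D.Arrow => ℝ)

/-- Relabelling coordinates preserves Lebesgue measure. Cholesky parameters can thus be indexed by
the edges, which makes the charts maps from one space to itself with honest determinants. -/
lemma measurePreserving_edgeCoord : MeasurePreserving D.edgeCoord volume volume :=
  (volume_measurePreserving_sumPiEquivProdPi fun _ : Fin p ⊕ D.Arrow => ℝ).comp
    (volume_measurePreserving_piCongrLeft (fun _ : D.Edge => ℝ) D.loopSumArrow).symm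

lemma edgeCoord_injective : Function.Injective D.edgeCoord := D.edgeCoordEquiv.injective

lemma edgeCoord_surjective : Function.Surjective D.edgeCoord := D.edgeCoordEquiv.surjective

lemma continuous_edgeCoord : Continuous D.edgeCoord := by
  unfold edgeCoord; fun_prop

/-- The Cholesky parameters as incomplete matrices. -/
def cholEdge : Set D.IncMatrix := D.edgeCoord ⁻¹' D.chol

lemma isOpen_cholEdge : IsOpen D.cholEdge := by
  refine IsOpen.preimage D.continuous_edgeCoord ?_
  rw [chol_eq_prod]
  exact (isOpen_set_pi finite_univ fun _ _ => isOpen_Ioi).prod isOpen_univ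

lemma edgeCoord_image_cholEdge : D.edgeCoord '' D.cholEdge = D.chol :=
  image_preimage_eq _ D.edgeCoord_surjective

/-- The incomplete precision matrix with the given Cholesky parameter. -/
noncomputable def precChart (θ : D.IncMatrix) : D.IncMatrix := D.proj (D.cholPrec (D.edgeCoord θ))

/-- The incomplete covariance matrix with the given Cholesky parameter. -/
noncomputable def covChart (θ : D.IncMatrix) : D.IncMatrix :=
  D.proj (D.cholPrec (D.edgeCoord θ))⁻¹

lemma injOn_precChart : InjOn D.precChart D.cholEdge := fun _ h _ h' e =>
  D.edgeCoord_injective (D.injOn_proj_cholPrec h h' e)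

lemma injOn_covChart : InjOn D.covChart D.cholEdge := fun _ h _ h' e =>
  D.edgeCoord_injective (D.injOn_proj_cholPrec_inv h h' e)

lemma image_precChart : D.precChart '' D.cholEdge = D.incPrec := by
  rw [incPrec, precSpace_eq_image, ← edgeCoord_image_cholEdge, image_image, image_image]
  rfl

lemma image_covChart : D.covChart '' D.cholEdge = D.incCov := by
  rw [incCov, covSpace_eq_image, ← edgeCoord_image_cholEdge, image_image, image_image]
  rfl

lemma exists_hasStrictFDerivAt_precChart {θ : D.IncMatrix} (hθ : θ ∈ D.cholEdge) :
    ∃ J : D.IncMatrix →L[ℝ] D.IncMatrix, HasStrictFDerivAt D.precChart J θ ∧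
      |J.det| = ∏ i, ((D.edgeCoord θ).1 i ^ ((D.pa i).card + 2))⁻¹ := by
  obtain ⟨J, hJ, hJ'⟩ := (D.exists_hasStrictFDerivAt_proj hθ).1
  exact ⟨J, hJ, D.abs_det_proj_cholPrec hθ hJ'⟩

lemma exists_hasStrictFDerivAt_covChart {θ : D.IncMatrix} (hθ : θ ∈ D.cholEdge) :
    ∃ J : D.IncMatrix →L[ℝ] D.IncMatrix, HasStrictFDerivAt D.covChart J θ ∧
      |J.det| = ∏ i, (sub (D.cholPrec (D.edgeCoord θ))⁻¹ (D.pa i)).det := by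
  obtain ⟨J, hJ, hJ'⟩ := (D.exists_hasStrictFDerivAt_proj hθ).2
  exact ⟨J, hJ, D.abs_det_proj_cholPrec_inv hθ hJ'⟩

end ParentOrderedDAG

/-- The image of an open set is open under a map with invertible strict derivatives. -/
lemma isOpen_image_of_hasStrictFDerivAt {E : Type*} [NormedAddCommGroup E] [NormedSpace ℝ E]
    [FiniteDimensional ℝ E] {f : E → E} {s : Set E} (hs : IsOpen s)
    (h : ∀ x ∈ s, ∃ J : E →L[ℝ] E, HasStrictFDerivAt f J x ∧ J.det ≠ 0) : IsOpen (f '' s) := by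
  have : CompleteSpace E := FiniteDimensional.complete ℝ E
  rw [isOpen_iff_mem_nhds]
  rintro _ ⟨x, hx, rfl⟩
  obtain ⟨J, hJ, hdet⟩ := h x hx
  rw [← J.coe_toContinuousLinearEquivOfDetNeZero hdet] at hJ
  rw [← hJ.map_nhds_eq_of_equiv]
  exact Filter.image_mem_map (hs.mem_nhds hx)

namespace ParentOrderedDAG

open scoped Classical Topology

variable {p : ℕ} (D : ParentOrderedDAG p)

/-- The chart has an open domain and nonvanishing Jacobian, so its image is open by the inverse
function theorem. -/
lemma isOpen_incPrec : IsOpen D.incPrec := by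
  rw [← image_precChart]
  refine isOpen_image_of_hasStrictFDerivAt D.isOpen_cholEdge fun θ hθ => ?_
  obtain ⟨J, hJ, hdet⟩ := D.exists_hasStrictFDerivAt_precChart hθ
  refine ⟨J, hJ, abs_pos.1 ?_⟩
  rw [hdet]
  exact Finset.prod_pos fun i _ => inv_pos.2 (pow_pos (hθ i) _)

lemma isOpen_incCov : IsOpen D.incCov := by
  rw [← image_covChart]
  refine isOpen_image_of_hasStrictFDerivAt D.isOpen_cholEdge fun θ hθ => ?_
  obtain ⟨J, hJ, hdet⟩ := D.exists_hasStrictFDerivAt_covChart hθ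
  refine ⟨J, hJ, abs_pos.1 ?_⟩
  rw [hdet]
  exact Finset.prod_pos fun i _ => (sub_posDef (D.cholPrec_inv_posDef hθ) _).det_pos

/-! ### Completions -/

lemma covCompletion_proj {S : Matrix (Fin p) (Fin p) ℝ} (hS : S ∈ D.covSpace) :
    D.covCompletion (D.proj S) = S :=
  D.injOn_proj_covSpace.leftInvOn_invFunOn hS

lemma precCompletion_proj {W : Matrix (Fin p) (Fin p) ℝ} (hW : W ∈ D.precSpace) :
    D.precCompletion (D.proj W) = W :=
  D.injOn_proj_precSpace.leftInvOn_invFunOn hW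

lemma existsUnique_covCompletion {G : D.IncMatrix} (hG : G ∈ D.incCov) :
    ∃! S, S ∈ D.covSpace ∧ D.proj S = G := by
  obtain ⟨S, hS, rfl⟩ := hG
  exact ⟨S, ⟨hS, rfl⟩, fun T hT => D.injOn_proj_covSpace hT.1 hS hT.2⟩

lemma existsUnique_precCompletion {G : D.IncMatrix} (hG : G ∈ D.incPrec) :
    ∃! W, W ∈ D.precSpace ∧ D.proj W = G := by
  obtain ⟨W, hW, rfl⟩ := hG
  exact ⟨W, ⟨hW, rfl⟩, fun T hT => D.injOn_proj_precSpace hT.1 hW hT.2⟩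

lemma precToCov_proj {W : Matrix (Fin p) (Fin p) ℝ} (hW : W ∈ D.precSpace) :
    D.precToCov (D.proj W) = D.proj W⁻¹ := by
  rw [precToCov, D.precCompletion_proj hW]

lemma cholPrec_inv_mem_covSpace {t : D.CholCoord} (ht : t ∈ D.chol) :
    (D.cholPrec t)⁻¹ ∈ D.covSpace := by
  rw [covSpace_eq_image]
  exact mem_image_of_mem _ ht

lemma cholPrec_mem_precSpace {t : D.CholCoord} (ht : t ∈ D.chol) :
    D.cholPrec t ∈ D.precSpace := by
  rw [precSpace_eq_image]
  exact mem_image_of_mem _ ht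

lemma precToCov_precChart {θ : D.IncMatrix} (hθ : θ ∈ D.cholEdge) :
    D.precToCov (D.precChart θ) = D.covChart θ :=
  D.precToCov_proj (D.cholPrec_mem_precSpace hθ)

/-- This is the transition map between two injective charts on the same parameters. -/
lemma bijOn_precToCov : BijOn D.precToCov D.incPrec D.incCov := by
  rw [← image_precChart, ← image_covChart]
  refine ⟨?_, ?_, ?_⟩
  · rintro _ ⟨θ, hθ, rfl⟩
    rw [D.precToCov_precChart hθ]
    exact mem_image_of_mem _ hθ
  · rintro _ ⟨θ, hθ, rfl⟩ _ ⟨η, hη, rfl⟩ h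
    rw [D.precToCov_precChart hθ, D.precToCov_precChart hη] at h
    rw [D.injOn_covChart hθ hη h]
  · rintro _ ⟨θ, hθ, rfl⟩
    exact ⟨_, mem_image_of_mem _ hθ, D.precToCov_precChart hθ⟩

lemma exists_edgeCoord_of_mem_covSpace {S : Matrix (Fin p) (Fin p) ℝ} (hS : S ∈ D.covSpace) :
    ∃ θ ∈ D.cholEdge, (D.cholPrec (D.edgeCoord θ))⁻¹ = S ∧
      S⁻¹ = D.cholPrec (D.edgeCoord θ) := by
  rw [covSpace_eq_image, ← edgeCoord_image_cholEdge, image_image] at hS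
  obtain ⟨θ, hθ, rfl⟩ := hS
  exact ⟨θ, hθ, rfl, Matrix.nonsing_inv_nonsing_inv _ (D.isUnit_det_cholPrec hθ)⟩

/-- The Jacobian of the map from incomplete precision to incomplete covariance matrices. -/
lemma exists_hasFDerivAt_precToCov {S : Matrix (Fin p) (Fin p) ℝ} (hS : S ∈ D.covSpace) :
    ∃ J : D.IncMatrix →L[ℝ] D.IncMatrix, HasFDerivAt D.precToCov J (D.proj S⁻¹) ∧
      |J.det| = ∏ i, (sub S (D.fa i)).det ^ ((D.pa i).card + 2)
        / (sub S (D.pa i)).det ^ ((D.pa i).card + 1) := by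
  obtain ⟨θ, hθ, hSθ, hSθ'⟩ := D.exists_edgeCoord_of_mem_covSpace hS
  obtain ⟨A, hA, hAdet⟩ := D.exists_hasStrictFDerivAt_precChart hθ
  obtain ⟨B, hB, hBdet⟩ := D.exists_hasStrictFDerivAt_covChart hθ
  have hA0 : A.det ≠ 0 := by
    rw [← abs_pos, hAdet]
    exact Finset.prod_pos fun i _ => inv_pos.2 (pow_pos (hθ i) _)
  set A' := A.toContinuousLinearEquivOfDetNeZero hA0 with hA'
  have hAA' : (A' : D.IncMatrix →L[ℝ] D.IncMatrix) = A :=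
    A.coe_toContinuousLinearEquivOfDetNeZero hA0
  rw [← hAA'] at hA
  set g := Function.invFunOn D.precChart D.cholEdge with hg
  have hginv : LeftInvOn g D.precChart D.cholEdge := D.injOn_precChart.leftInvOn_invFunOn
  -- The chosen inverse `g` is a left inverse on an open set, so strict differentiability of the
  -- chart differentiates it without a separate continuity proof.
  have hgd := hA.to_local_left_inverse (g := g) <|
    Filter.mem_of_superset (D.isOpen_cholEdge.mem_nhds hθ) fun η hη => hginv hη
  have hgθ : g (D.precChart θ) = θ := hginv hθ
  have hcomp : HasFDerivAt (D.covChart ∘ g)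
      (B ∘L (A'.symm : D.IncMatrix →L[ℝ] D.IncMatrix)) (D.precChart θ) := by
    refine HasFDerivAt.comp _ ?_ hgd.hasFDerivAt
    rw [hgθ]
    exact hB.hasFDerivAt
  have hpt : D.proj S⁻¹ = D.precChart θ := by rw [hSθ']; rfl
  rw [hpt]
  refine ⟨_, hcomp.congr_of_eventuallyEq ?_, ?_⟩
  · have hmem : D.incPrec ∈ 𝓝 (D.precChart θ) :=
      D.isOpen_incPrec.mem_nhds (D.image_precChart ▸ mem_image_of_mem _ hθ)
    filter_upwards [hmem] with G hG
    rw [← image_precChart] at hG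
    obtain ⟨η, hη, rfl⟩ := hG
    rw [D.precToCov_precChart hη, Function.comp_apply, hginv hη]
  · have hmul : (A'.symm : D.IncMatrix →L[ℝ] D.IncMatrix).det * A.det = 1 := by
      rw [← hAA', ContinuousLinearMap.det, ContinuousLinearMap.det, ← LinearMap.det_comp]
      convert! LinearMap.det_id using 2
      ext x
      simp
    have hsplit : (B ∘L (A'.symm : D.IncMatrix →L[ℝ] D.IncMatrix)).det =
        B.det * (A'.symm : D.IncMatrix →L[ℝ] D.IncMatrix).det := by
      rw [ContinuousLinearMap.det, ContinuousLinearMap.det, ContinuousLinearMap.det,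
        ← LinearMap.det_comp]
      rfl
    rw [hsplit, eq_inv_of_mul_eq_one_left hmul, abs_mul, abs_inv, hAdet, hBdet, hSθ,
      ← Finset.prod_inv_distrib, ← Finset.prod_mul_distrib]
    -- The factor at `i` is `det Σ_pa(i) * D i ^ (pa i + 2)`; substituting `D i = det Σ_fa(i) / det
    -- Σ_pa(i)` leaves the exponent `pa i + 1` below.
    refine Finset.prod_congr rfl fun i _ => ?_
    have h0 : 0 < (sub S (D.pa i)).det := by
      rw [← hSθ]; exact (sub_posDef (D.cholPrec_inv_posDef hθ) _).det_pos
    have hfa := D.det_sub_fa_cholPrec_inv hθ i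
    rw [hSθ] at hfa
    rw [inv_inv, hfa, mul_pow, eq_div_iff (by positivity)]
    ring

/-! ### The inverse DAG-Wishart distributions -/

lemma continuousOn_cholPrec_inv : ContinuousOn (fun t => (D.cholPrec t)⁻¹) D.chol := by
  intro t ht
  have h : ContinuousAt Ring.inverse (D.cholPrec t).det := by
    have : (Ring.inverse : ℝ → ℝ) = Inv.inv := by ext; simp
    rw [this]
    exact continuousAt_inv₀ (D.isUnit_det_cholPrec ht).ne_zero
  exact (continuousAt_matrix_inv _ h).comp_continuousWithinAt (D.continuousOn_cholPrec t ht)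

lemma continuous_proj : Continuous D.proj :=
  continuous_pi fun e => continuous_id.matrix_elem e.1.1 e.1.2

instance : BorelSpace (Matrix (Fin p) (Fin p) ℝ) :=
  inferInstanceAs (BorelSpace (Fin p → Fin p → ℝ))

lemma wishartChol_absolutelyContinuous (U : Matrix (Fin p) (Fin p) ℝ) (α : Fin p → ℝ) :
    D.wishartChol U α ≪ volume.restrict D.chol := withDensity_absolutelyContinuous _ _

lemma aemeasurable_cholPrec_inv (U : Matrix (Fin p) (Fin p) ℝ) (α : Fin p → ℝ) :
    AEMeasurable (fun t => (D.cholPrec t)⁻¹) (D.wishartChol U α) :=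
  (D.continuousOn_cholPrec_inv.aemeasurable D.measurableSet_chol).mono_ac
    (D.wishartChol_absolutelyContinuous U α)

lemma measurable_proj : Measurable D.proj := D.continuous_proj.measurable

lemma map_proj_invWishartCov (U : Matrix (Fin p) (Fin p) ℝ) (α : Fin p → ℝ) :
    (D.invWishartCov U α).map D.proj = D.invWishartInc U α := by
  rw [invWishartCov, AEMeasurable.map_map_of_aemeasurable D.measurable_proj.aemeasurable
    (D.aemeasurable_cholPrec_inv U α)]
  rfl

/-- An injective image of a Borel set under a map continuous on it is Borel, so no measurability of
the Markov condition has to be checked directly. -/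
lemma measurableSet_covSpace : MeasurableSet D.covSpace := by
  rw [covSpace_eq_image]
  refine D.measurableSet_chol.image_of_continuousOn_injOn D.continuousOn_cholPrec_inv ?_
  exact fun t ht t' ht' h => D.injOn_proj_cholPrec_inv ht ht' (congrArg D.proj h)

lemma ae_invWishartCov_mem_covSpace (U : Matrix (Fin p) (Fin p) ℝ) (α : Fin p → ℝ) :
    ∀ᵐ S ∂D.invWishartCov U α, S ∈ D.covSpace := by
  refine (ae_map_iff (D.aemeasurable_cholPrec_inv U α) D.measurableSet_covSpace).2 ?_
  filter_upwards [(D.wishartChol_absolutelyContinuous U α).ae_le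
    (ae_restrict_mem D.measurableSet_chol)] with t ht using D.cholPrec_inv_mem_covSpace ht

/-- The density of the inverse DAG-Wishart distribution at an incomplete covariance matrix, times
the Jacobian of the Cholesky parametrization, is the density of the DAG-Wishart distribution. -/
lemma jacobian_mul_density (α : Fin p → ℝ) {t : D.CholCoord}
    (ht : t ∈ D.chol) {c : ℝ} :
    (∏ i, (sub (D.cholPrec t)⁻¹ (D.pa i)).det) * (c *
      ∏ i, (sub (D.cholPrec t)⁻¹ (D.fa i)).det ^ (-(1 / 2) * α i)
          / (sub (D.cholPrec t)⁻¹ (D.pa i)).det ^ (-(1 / 2) * α i + 1)) =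
      c * ∏ i, t.1 i ^ (-(1 / 2) * α i) := by
  rw [mul_left_comm, ← Finset.prod_mul_distrib]
  congr 1
  refine Finset.prod_congr rfl fun i _ => ?_
  have h0 : 0 < (sub (D.cholPrec t)⁻¹ (D.pa i)).det :=
    (sub_posDef (D.cholPrec_inv_posDef ht) _).det_pos
  -- The extra `+ 1` in the exponent of `det Σ_pa(i)` is cancelled by the Jacobian, and the
  -- remaining powers of `det Σ_pa(i)` cancel each other.
  rw [D.det_sub_fa_cholPrec_inv ht, Real.mul_rpow h0.le (ht i).le, Real.rpow_add_one h0.ne']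
  have := Real.rpow_pos_of_pos h0 (-(1 / 2) * α i)
  field_simp

/-- The inverse DAG-Wishart distribution on the incomplete covariance matrices has the stated
Lebesgue density. -/
lemma invWishartInc_eq_densityMeasure (U : Matrix (Fin p) (Fin p) ℝ) (α : Fin p → ℝ) :
    D.invWishartInc U α = D.densityMeasure U α := by
  have hF : AEMeasurable (fun t => D.proj (D.cholPrec t)⁻¹) (D.wishartChol U α) :=
    D.measurable_proj.comp_aemeasurable (D.aemeasurable_cholPrec_inv U α)
  ext A hA
  set h : D.IncMatrix → ℝ≥0∞ := fun G => ENNReal.ofReal ((D.normConst U α)⁻¹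
      * Real.exp (-(1 / 2) * ((D.covCompletion G)⁻¹ * U).trace)
      * ∏ i, (sub (D.covCompletion G) (D.fa i)).det ^ (-(1 / 2) * α i)
          / (sub (D.covCompletion G) (D.pa i)).det ^ (-(1 / 2) * α i + 1)) with hh
  set f : D.CholCoord → ℝ≥0∞ := fun t =>
    ENNReal.ofReal ((D.normConst U α)⁻¹ * Real.exp (-(1 / 2) * (D.cholPrec t * U).trace)
      * ∏ i, t.1 i ^ (-(1 / 2) * α i)) with hf
  -- Testing against an indicator keeps `h` an arbitrary integrand. No measurability of the
  -- completion, which is made by choice, is needed, because the change of variables for injective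
  -- maps holds for every integrand.
  have hind : Measurable (A.indicator (1 : D.IncMatrix → ℝ≥0∞)) := measurable_one.indicator hA
  have hcov : MeasurableSet D.incCov := D.isOpen_incCov.measurableSet
  have hchart : MeasurableSet D.cholEdge := D.isOpen_cholEdge.measurableSet
  calc D.invWishartInc U α A
      = ∫⁻ t, A.indicator 1 (D.proj (D.cholPrec t)⁻¹) ∂D.wishartChol U α := by
        rw [invWishartInc, ← lintegral_indicator_one hA, lintegral_map' hind.aemeasurable hF]
    _ = ∫⁻ t in D.chol, f t * A.indicator 1 (D.proj (D.cholPrec t)⁻¹) :=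
        lintegral_withDensity_eq_lintegral_mul₀' (D.aemeasurable_wishartChol_density U α)
          (hind.comp_aemeasurable hF)
    _ = ∫⁻ θ in D.cholEdge, f (D.edgeCoord θ) * A.indicator 1 (D.covChart θ) :=
        (D.measurePreserving_edgeCoord.setLIntegral_comp_preimage_emb
          D.edgeCoordEquiv.measurableEmbedding _ _).symm
    _ = ∫⁻ θ in D.cholEdge, ENNReal.ofReal |(fderiv ℝ D.covChart θ).det| *
          (h (D.covChart θ) * A.indicator 1 (D.covChart θ)) := by
        refine setLIntegral_congr_fun hchart fun θ hθ => ?_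
        obtain ⟨J, hJ, hdet⟩ := D.exists_hasStrictFDerivAt_covChart hθ
        have hS := D.cholPrec_inv_mem_covSpace hθ
        have hcomp : D.covCompletion (D.covChart θ) = (D.cholPrec (D.edgeCoord θ))⁻¹ :=
          D.covCompletion_proj hS
        have hinv : (D.cholPrec (D.edgeCoord θ))⁻¹⁻¹ = D.cholPrec (D.edgeCoord θ) :=
          Matrix.nonsing_inv_nonsing_inv _ (D.isUnit_det_cholPrec hθ)
        simp only [hh, hf]
        rw [hJ.hasFDerivAt.fderiv, ← mul_assoc, ← ENNReal.ofReal_mul (abs_nonneg _), hdet, hcomp,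
          hinv, D.jacobian_mul_density α hθ]
    _ = ∫⁻ G in D.incCov, h G * A.indicator 1 G := by
        rw [← image_covChart]
        refine (lintegral_image_eq_lintegral_abs_det_fderiv_mul volume hchart (fun θ hθ => ?_)
          D.injOn_covChart (fun G => h G * A.indicator 1 G)).symm
        obtain ⟨J, hJ, -⟩ := D.exists_hasStrictFDerivAt_covChart hθ
        exact hJ.hasFDerivAt.differentiableAt.hasFDerivAt.hasFDerivWithinAt
    _ = D.densityMeasure U α A := by
        rw [densityMeasure, withDensity_apply _ hA, ← lintegral_indicator hA]
        refine lintegral_congr fun G => ?_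
        by_cases hG : G ∈ A <;> simp [hG, hh]

lemma isProbabilityMeasure_invWishartInc {U : Matrix (Fin p) (Fin p) ℝ} (hU : U.PosDef)
    {α : Fin p → ℝ} (hα : ∀ i, ((D.pa i).card : ℝ) + 2 < α i) :
    IsProbabilityMeasure (D.invWishartInc U α) := by
  have : IsProbabilityMeasure (D.wishartChol U α) := ⟨D.wishartChol_univ hU hα⟩
  exact Measure.isProbabilityMeasure_map
    (D.measurable_proj.comp_aemeasurable (D.aemeasurable_cholPrec_inv U α))

end ParentOrderedDAG

theorem corollary3 {p : ℕ} (D : ParentOrderedDAG p) :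
    -- completions are unique, so the spaces and maps below are well defined
    (∀ G ∈ D.incCov, ∃! S, S ∈ D.covSpace ∧ D.proj S = G) ∧
    (∀ G ∈ D.incPrec, ∃! W, W ∈ D.precSpace ∧ D.proj W = G) ∧
    IsOpen D.incPrec ∧ IsOpen D.incCov ∧
    -- the map from incomplete precision to incomplete covariance matrices and its Jacobian
    BijOn D.precToCov D.incPrec D.incCov ∧
    (∀ S ∈ D.covSpace,
      D.precToCov (D.proj S⁻¹) = D.proj S ∧
      ∃ J : D.IncMatrix →L[ℝ] D.IncMatrix,
        HasFDerivAt D.precToCov J (D.proj S⁻¹) ∧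
        |J.det| = ∏ i, (ParentOrderedDAG.sub S (D.fa i)).det ^ ((D.pa i).card + 2)
          / (ParentOrderedDAG.sub S (D.pa i)).det ^ ((D.pa i).card + 1)) ∧
    -- the Lebesgue density of the inverse DAG-Wishart distribution
    (∀ (U : Matrix (Fin p) (Fin p) ℝ) (α : Fin p → ℝ), U.PosDef →
      (∀ i, ((D.pa i).card : ℝ) + 2 < α i) →
      IsProbabilityMeasure (D.invWishartInc U α) ∧
      D.invWishartInc U α = D.densityMeasure U α ∧
      ∀ {Ω : Type*} [MeasurableSpace Ω] (P : Measure Ω) (S : Ω → Matrix (Fin p) (Fin p) ℝ),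
        HasLaw S (D.invWishartCov U α) P →
          (∀ᵐ ω ∂P, S ω ∈ D.covSpace ∧ D.covCompletion (D.proj (S ω)) = S ω) ∧
          HasLaw (fun ω => D.proj (S ω)) (D.densityMeasure U α) P) := by
  refine ⟨fun G => D.existsUnique_covCompletion, fun G => D.existsUnique_precCompletion,
    D.isOpen_incPrec, D.isOpen_incCov, D.bijOn_precToCov, fun S hS => ⟨?_, ?_⟩,
    fun U α hU hα => ⟨D.isProbabilityMeasure_invWishartInc hU hα,
      D.invWishartInc_eq_densityMeasure U α, fun P S hS => ⟨?_, ?_, ?_⟩⟩⟩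
  · obtain ⟨θ, hθ, hSθ, hSθ'⟩ := D.exists_edgeCoord_of_mem_covSpace hS
    rw [hSθ', D.precToCov_proj (D.cholPrec_mem_precSpace hθ), hSθ]
  · exact D.exists_hasFDerivAt_precToCov hS
  · have h := D.ae_invWishartCov_mem_covSpace U α
    rw [← hS.map_eq] at h
    filter_upwards [ae_of_ae_map hS.aemeasurable h] with ω hω
      using ⟨hω, D.covCompletion_proj hω⟩
  · exact D.measurable_proj.comp_aemeasurable hS.aemeasurable
  · rw [← D.invWishartInc_eq_densityMeasure, ← D.map_proj_invWishartCov, ← hS.map_eq,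
      AEMeasurable.map_map_of_aemeasurable D.measurable_proj.aemeasurable hS.aemeasurable]
    rfl
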